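/- **Notation.** Let $N\ge 1$ be an integer and let $C$ be the Cartan matrix of $A_{N-1}$, $C_{ij}=2\delta_{i,j}-\delta_{|i-j|,1}$ ($1\le i,j\le N-1$), $\mathcal I=2I-C$, and $e_1,\dots,e_{N-1}$ the standard unit vectors. Write $(q)_n=\prod_{k=1}^n(1-q^k)$ and $\left[{a\atop b}\right]=\frac{(q)_a}{(q)_b(q)_{a-b}}$ if $b\ge0$ and $a-b\ge0$, and $0$ otherwise; for vectors $\left[{m+n\atop n}\right]=\prod_{k=1}^{N-1}\left[{m_k+n_k\atop n_k}\right]$, and $nC^{-1}n=\sum_{i,j}n_iC^{-1}_{ij}n_j$. Put $M_{12}=M_1-M_2$. Burge's polynomial is $$X_{r,s}^{(p,p')}(M_1,L_1,M_2,L_2)=\sum_{j\in\mathbb Z}\Big\{q^{j(pp'j+p'(M_{12}+r)-ps)}\left[{M_1+L_1-(p'-p)j\atop M_1+pj}\right]\left[{M_2+L_2+(p'-p)j\atop M_2-pj}\right]$$ $$\qquad-q^{(pj+M_{12}+r)(p'j+s)}\left[{M_1+L_1-(p'-p)j+r-s\atop M_1+pj+r}\right]\left[{M_2+L_2+(p'-p)j-r+s\atop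 M_2-pj-r}\right]\Big\}.$$ For $\sigma\in\{0,1\}$, if $N$ divides $p'-p$ and $r-s$, its level-$N$ version is $$X_{r,s,\sigma}^{(p,p'),N}(M_1,L_1,M_2,L_2)=\sum_{j\in\mathbb Z}q^{\frac jN(pp'j+p'(M_{12}+r)-ps)}\sum_{\eta}q^{\eta C^{-1}\eta}\left[{\mu+\eta\atop\eta}\right]\left[{M_1+L_1-\frac{(p'-p)j}N-\frac12(M_2-pj-\mu_1)\atop M_1+pj}\right]\left[{M_2+L_2+\frac{(p'-p)j}N-\frac12(M_1+pj-\mu_{N-1})\atop M_2-pj}\right]$$ $$-\sum_{j\in\mathbb Z}q^{\frac1N(pj+M_{12}+r)(p'j+s)}\sum_{\eta}q^{\eta C^{-1}\eta}\left[{\mu+\eta\atop\eta}\right]\left[{M_1+L_1-\frac{(p'-p)j-r+s}N-\frac12(M_2-pj-r-\mu_1)\atop M_1+pj+r}\right]\left[{M_2+L_2+\frac{(p'-p)j-r+s}N-\frac12(M_1+pj+r-\mu_{N-1})\atop M_2-pj-r}\right].$$ In the first part $\eta$ runs over the elements of $\mathbb Z^{N-1}$ with $\frac{M_{12}+2pj+\sigma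 N}{2N}+(C^{-1}\eta)_1\in\mathbb Z$ and $\mu$ is determined by $\mu+\eta=\frac12(\mathcal I\mu+(M_1+pj)e_1+(M_2-pj)e_{N-1})$; in the second part $\eta$ runs over those with $\frac{M_{12}+2pj+2r+\sigma N}{2N}+(C^{-1}\eta)_1\in\mathbb Z$ and $\mu+\eta=\frac12(\mathcal I\mu+(M_1+pj+r)e_1+(M_2-pj-r)e_{N-1})$. For $N=1$ the sums over $\eta$ (and over $n$ below) consist of one term, $(C^{-1}\eta)_1$ is read as $0$, $\mu_1$ as $M_2-pj$ (resp. $M_2-pj-r$), $\mu_0$ as $M_1+pj$ (resp. $M_1+pj+r$), and below $m_1$ as $0$. **Theorem.** Let $N\ge1$, $\sigma\in\{0,1\}$, and let $p,p',r,s$ be integers with $1\le p<p'$. (a) Let $M_1,M_2,L_1+\frac{M_{12}+\sigma}2,L_2+\frac{M_{12}+\sigma}2$ be integers with $M_{12}+\sigma N$ even. Assume $$\left\lfloor\frac{L_1+M_{12}\frac{N-1}{2N}-s-\frac rN}{p'+\frac pN}\right\rfloor\le\left\lfloor\frac{L_1+M_{12}+r-s}{p'-p}\right\rfloor,\qquad\left\lfloor\frac{L_2-M_{12}\frac{N-1}{2N}+s+\frac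 rN}{p'+\frac pN}\right\rfloor\le\left\lfloor\frac{L_2-M_{12}-r+s}{p'-p}\right\rfloor,$$ together with the two inequalities obtained from these by setting $r=s=0$. Then $$X_{r,r+Ns,\sigma}^{(p,p+Np'),N}(M_1,L_1,M_2,L_2)=\sum_{i\in\mathbb Z}q^{i(i+M_{12})/N}\left[{L_1+L_2+M_2-i\atop M_2-i}\right]\sum_nq^{nC^{-1}n}\left[{m+n\atop n}\right]X_{r,s}^{(p,p')}\big(i+M_{12},\,L_1-i+\tfrac12m_1,\,i,\,L_2-M_{12}-i+\tfrac12m_1\big),$$ where $n$ runs over the elements of $\mathbb Z^{N-1}$ with $\frac{2i+M_{12}+\sigma N}{2N}+(C^{-1}n)_1\in\mathbb Z$, and $m$ is determined by $m+n=\frac12(\mathcal Im+(2i+M_{12})e_1)$. (b) Suppose $0\le r\le p$ and $0\le s\le p'$, let $M$ and $L+\frac\sigma2$ be integers with $\sigma N$ even, and assume $$\left\lfloor\frac{L+s+\frac rN}{p'+\frac pN}\right\rfloor\le\left\lfloor\frac{L-r+s}{p'-p}\right\rfloor.$$ Then $$X_{r,r+Ns,\sigma}^{(p,p+Np'),N}(M,L,M,L)=\sum_{i=0}^Mq^{i^2/N}\left[{2L+M-i\atop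 2L}\right]\sum_nq^{nC^{-1}n}\left[{m+n\atop n}\right]X_{r,s}^{(p,p')}\big(i,L-i+\tfrac12m_1,i,L-i+\tfrac12m_1\big),$$ where $n$ runs over the elements of $\mathbb Z^{N-1}$ with $\frac{2i+\sigma N}{2N}+(C^{-1}n)_1\in\mathbb Z$, and $m+n=\frac12(\mathcal Im+2ie_1)$. In all these sums only finitely many terms are non-zero. -/

import Mathlib

open scoped Matrix

namespace Burge

noncomputable section

/-! ### Formal `q`-series with rational exponents -/

/-- Formal series in `q` with rational exponents and rational coefficients. This is a field, so the
quotients defining the `q`-binomials can be formed literally. -/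
abbrev QSeries : Type := HahnSeries ℚ ℚ

/-- The monomial `q ^ a`, for a rational exponent `a`. -/
def qPow (a : ℚ) : QSeries := HahnSeries.single a 1

/-- `(q)_n = (1 - q) (1 - q ^ 2) ⋯ (1 - q ^ n)`. -/
def qPoch (n : ℕ) : QSeries := ∏ k ∈ Finset.range n, (1 - qPow ((k : ℚ) + 1))

/-- The `q`-binomial coefficient with upper entry `t` and lower entry `b`. If `b` and `t - b` are
non-negative integers `m` and `n`, it is `(q)_{m+n} / ((q)_m (q)_n)`; otherwise it is `0`. The
entries are typed as rational numbers since they are written with half-integers; under the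
parity and restriction conditions below, they are always integers. -/
def qBinom (t b : ℚ) : QSeries :=
  if t.isInt ∧ b.isInt ∧ 0 ≤ b ∧ b ≤ t then
    qPoch t.num.toNat / (qPoch b.num.toNat * qPoch (t - b).num.toNat)
  else 0

/-- A rational number is an integer. -/
def IsInt (x : ℚ) : Prop := ∃ z : ℤ, x = z

/-! ### The Cartan matrix of type `A_{N-1}` and the `(m,n)`-systems

Vectors in `ℤ^{N-1}` are indexed by `Fin (N - 1)`: the component with (one-based) number `j` is the
entry at the index whose value is `j - 1`. -/

/-- The Cartan matrix of `A_{N-1}`, with rational entries. -/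
def cartan (N : ℕ) : Matrix (Fin (N - 1)) (Fin (N - 1)) ℚ :=
  (CartanMatrix.A (N - 1)).map (fun z : ℤ => (z : ℚ))

/-- The vector `a e_1 + b e_{N-1}`. -/
def source (N : ℕ) (a b : ℚ) : Fin (N - 1) → ℚ :=
  fun k => (if k.val = 0 then a else 0) + (if k.val + 2 = N then b else 0)

/-- An integer vector, read as a rational vector. -/
def toRat {N : ℕ} (n : Fin (N - 1) → ℤ) : Fin (N - 1) → ℚ := fun k => (n k : ℚ)

/-- The solution `m` of the system `m + n = (I m + a e_1 + b e_{N-1}) / 2`, where `I = 2 - C` is the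
incidence matrix; see `solution_unique`. -/
def solution (N : ℕ) (a b : ℚ) (n : Fin (N - 1) → ℤ) : Fin (N - 1) → ℚ :=
  (cartan N)⁻¹ *ᵥ (source N a b - (2 : ℚ) • toRat n)

theorem cartan_mulVec_injective (N : ℕ) (v : Fin (N - 1) → ℚ) (hv : cartan N *ᵥ v = 0) :
    v = 0 := by
  obtain ⟨d, hd⟩ : ∃ d, N - 1 = d := ⟨_, rfl⟩
  unfold cartan at hv
  revert v
  rw [hd]
  intro v hv
  -- extend `v` by zero on both sides
  let x : ℕ → ℚ := fun j => if h : 1 ≤ j ∧ j ≤ d then v ⟨j - 1, by omega⟩ else 0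
  have hx0 : x 0 = 0 := by simp [x]
  have hxd : x (d + 1) = 0 := by simp [x]
  have hvx : ∀ k : Fin d, v k = x (k.val + 1) := by
    intro k
    have : k.val + 1 ≤ d := k.isLt
    simp [x, this]
  have hrec : ∀ k, k < d → 2 * x (k + 1) = x k + x (k + 2) := by
    intro k hk
    have h := congrFun hv ⟨k, hk⟩
    simp only [Matrix.mulVec, dotProduct, Matrix.map_apply, CartanMatrix.A, Matrix.of_apply,
      Pi.zero_apply] at h
    have e : ∀ j : Fin d, (((if (⟨k, hk⟩ : Fin d) = j then (2 : ℤ)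
        else if k + 1 = j.val ∨ j.val + 1 = k then -1 else 0 : ℤ) : ℚ)) * v j
        = (if k = j.val then 2 * x (j.val + 1) else 0)
          - (if k + 1 = j.val then x (j.val + 1) else 0)
          - (if j.val + 1 = k then x (j.val + 1) else 0) := by
      intro j
      rw [hvx j]
      simp only [Fin.ext_iff]
      split_ifs <;> first | omega | simp
    simp only [e] at h
    rw [Fin.sum_univ_eq_sum_range (fun j => (if k = j then 2 * x (j + 1) else 0)
          - (if k + 1 = j then x (j + 1) else 0)
          - (if j + 1 = k then x (j + 1) else 0)) d,
      Finset.sum_sub_distrib, Finset.sum_sub_distrib, Finset.sum_ite_eq, Finset.sum_ite_eq] at h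
    have h3 : ∑ j ∈ Finset.range d, (if j + 1 = k then x (j + 1) else 0) = x k := by
      rcases k with _ | k
      · simp [hx0]
      · simp only [add_left_inj]
        rw [Finset.sum_ite_eq', if_pos (Finset.mem_range.mpr (by omega))]
    have h2 : (if k + 1 ∈ Finset.range d then x (k + 1 + 1) else 0) = x (k + 2) := by
      by_cases hk' : k + 1 < d
      · rw [if_pos (Finset.mem_range.mpr hk')]
      · rw [if_neg (by simpa using hk')]
        have : k + 2 = d + 1 := by omega
        rw [this, hxd]
    rw [h3, h2, if_pos (Finset.mem_range.mpr hk)] at h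
    linarith
  have hlin : ∀ k, k ≤ d → x k = k * x 1 ∧ x (k + 1) = (k + 1) * x 1 := by
    intro k
    induction k with
    | zero => intro _; simp [hx0]
    | succ k ih =>
      intro hk
      obtain ⟨h1, h2⟩ := ih (by omega)
      have h3 := hrec k (by omega)
      refine ⟨by push_cast; exact h2, ?_⟩
      push_cast
      have : x (k + 1 + 1) = x (k + 2) := rfl
      rw [this]
      linarith
  have hx1 : x 1 = 0 := by
    have h := (hlin d le_rfl).2
    rw [hxd] at h
    have hpos : (d : ℚ) + 1 ≠ 0 := by positivity
    rcases mul_eq_zero.mp h.symm with h | h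
    · exact absurd h hpos
    · exact h
  funext k
  rw [hvx k, (hlin k.val k.isLt.le).2, hx1]
  simp

/-- The Cartan matrix is invertible, so that its Mathlib inverse is a genuine inverse. -/
theorem cartan_isUnit_det (N : ℕ) : IsUnit (cartan N).det := by
  rw [isUnit_iff_ne_zero]
  intro h
  obtain ⟨v, hv, hv'⟩ := Matrix.exists_mulVec_eq_zero_iff.mpr h
  exact hv (cartan_mulVec_injective N v hv')

/-- The `(m,n)`-system determines `m` from `n`, and `solution` is its unique solution. -/
theorem solution_unique (N : ℕ) (a b : ℚ) (n : Fin (N - 1) → ℤ) (m : Fin (N - 1) → ℚ) :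
    m + toRat n = (1 / 2 : ℚ) • (((2 : ℚ) • (1 : Matrix (Fin (N - 1)) (Fin (N - 1)) ℚ) - cartan N)
        *ᵥ m + source N a b) ↔ m = solution N a b n := by
  have key : m = solution N a b n ↔ cartan N *ᵥ m = source N a b - (2 : ℚ) • toRat n := by
    constructor
    · rintro rfl
      rw [solution, Matrix.mulVec_mulVec, Matrix.mul_nonsing_inv _ (cartan_isUnit_det N),
        Matrix.one_mulVec]
    · intro h
      rw [solution, ← h, Matrix.mulVec_mulVec, Matrix.nonsing_inv_mul _ (cartan_isUnit_det N),
        Matrix.one_mulVec]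
  rw [key, Matrix.sub_mulVec, Matrix.smul_mulVec, Matrix.one_mulVec]
  constructor
  · intro h
    funext k
    have := congrFun h k
    simp only [Pi.add_apply, Pi.smul_apply, Pi.sub_apply, smul_eq_mul] at this ⊢
    linarith
  · intro h
    funext k
    have := congrFun h k
    simp only [Pi.add_apply, Pi.smul_apply, Pi.sub_apply, smul_eq_mul] at this ⊢
    linarith

/-- The `j`-th component (one-based) of a vector `v` in `ℚ^{N-1}`, extended by the boundary values
`v_0 = a` and `v_N = b`. For `N ≥ 2` and `j = 1, N - 1` the boundary values play no role; for
`N = 1` they give `v_1 = b` and `v_{N-1} = v_0 = a`. -/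
def component {N : ℕ} (a b : ℚ) (v : Fin (N - 1) → ℚ) (j : ℕ) : ℚ :=
  if h : 1 ≤ j ∧ j ≤ N - 1 then v ⟨j - 1, by omega⟩ else if j = 0 then a else b

/-- The condition `(ℓ + σ N) / (2 N) + (C⁻¹ n)_1 ∈ ℤ`, where `(C⁻¹ n)_1` is read as `0` if
`N = 1`. -/
def Restricted (N : ℕ) (σ ℓ : ℤ) (n : Fin (N - 1) → ℤ) : Prop :=
  IsInt (((ℓ : ℚ) + σ * N) / (2 * N) + component 0 0 ((cartan N)⁻¹ *ᵥ toRat n) 1)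

/-- `q ^ (n C⁻¹ n) ∏_j [m_j + n_j ; n_j]`, where `m` is determined by `n` through the system
`m + n = (I m + a e_1 + b e_{N-1}) / 2`. -/
def weight (N : ℕ) (a b : ℚ) (n : Fin (N - 1) → ℤ) : QSeries :=
  qPow (toRat n ⬝ᵥ ((cartan N)⁻¹ *ᵥ toRat n)) *
    ∏ k, qBinom (solution N a b n k + n k) (n k)

/-! ### Burge's polynomials -/

/-- The summand of index `j` in Burge's polynomial. -/
def burgeTerm (p p' r s M₁ : ℤ) (L₁ : ℚ) (M₂ : ℤ) (L₂ : ℚ) (j : ℤ) : QSeries :=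
  qPow (j * (p * p' * j + p' * (M₁ - M₂ + r) - p * s)) *
      qBinom (M₁ + L₁ - (p' - p) * j) (M₁ + p * j) *
      qBinom (M₂ + L₂ + (p' - p) * j) (M₂ - p * j)
    - qPow ((p * j + (M₁ - M₂) + r) * (p' * j + s)) *
      qBinom (M₁ + L₁ - (p' - p) * j + r - s) (M₁ + p * j + r) *
      qBinom (M₂ + L₂ + (p' - p) * j - r + s) (M₂ - p * j - r)

/-- Burge's polynomial `X_{r,s}^{(p,p')}(M₁, L₁, M₂, L₂)`. -/
def burgeX (p p' r s M₁ : ℤ) (L₁ : ℚ) (M₂ : ℤ) (L₂ : ℚ) : QSeries :=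
  ∑ᶠ j : ℤ, burgeTerm p p' r s M₁ L₁ M₂ L₂ j

/-! ### The level-`N` polynomials -/

open Classical in
/-- The summand of index `η` in the inner sum of the positive part, with
`μ + η = (I μ + (M₁ + p j) e_1 + (M₂ - p j) e_{N-1}) / 2`. For `N = 1` one reads `μ_1 = M₂ - p j`
and `μ_0 = M₁ + p j`. -/
def posInner (N : ℕ) (σ p p' M₁ : ℤ) (L₁ : ℚ) (M₂ : ℤ) (L₂ : ℚ) (j : ℤ)
    (η : Fin (N - 1) → ℤ) : QSeries :=
  let a : ℚ := M₁ + p * j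
  let b : ℚ := M₂ - p * j
  let μ : Fin (N - 1) → ℚ := solution N a b η
  if Restricted N σ (M₁ - M₂ + 2 * p * j) η then
    weight N a b η *
      qBinom (M₁ + L₁ - (p' - p) * j / N - (1 / 2) * (M₂ - p * j - component a b μ 1))
        (M₁ + p * j) *
      qBinom (M₂ + L₂ + (p' - p) * j / N - (1 / 2) * (M₁ + p * j - component a b μ (N - 1)))
        (M₂ - p * j)
  else 0

open Classical in
/-- The summand of index `η` in the inner sum of the negative part, with
`μ + η = (I μ + (M₁ + p j + r) e_1 + (M₂ - p j - r) e_{N-1}) / 2`. For `N = 1` one reads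
`μ_1 = M₂ - p j - r` and `μ_0 = M₁ + p j + r`. -/
def negInner (N : ℕ) (σ p p' r s M₁ : ℤ) (L₁ : ℚ) (M₂ : ℤ) (L₂ : ℚ) (j : ℤ)
    (η : Fin (N - 1) → ℤ) : QSeries :=
  let a : ℚ := M₁ + p * j + r
  let b : ℚ := M₂ - p * j - r
  let μ : Fin (N - 1) → ℚ := solution N a b η
  if Restricted N σ (M₁ - M₂ + 2 * p * j + 2 * r) η then
    weight N a b η *
      qBinom (M₁ + L₁ - ((p' - p) * j - r + s) / N
          - (1 / 2) * (M₂ - p * j - r - component a b μ 1))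
        (M₁ + p * j + r) *
      qBinom (M₂ + L₂ + ((p' - p) * j - r + s) / N
          - (1 / 2) * (M₁ + p * j + r - component a b μ (N - 1)))
        (M₂ - p * j - r)
  else 0

/-- The summand of index `j` in the positive part of the level-`N` polynomial. -/
def posTerm (N : ℕ) (σ p p' r s M₁ : ℤ) (L₁ : ℚ) (M₂ : ℤ) (L₂ : ℚ) (j : ℤ) : QSeries :=
  qPow ((j : ℚ) / N * (p * p' * j + p' * (M₁ - M₂ + r) - p * s)) *
    ∑ᶠ η : Fin (N - 1) → ℤ, posInner N σ p p' M₁ L₁ M₂ L₂ j η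

/-- The summand of index `j` in the negative part of the level-`N` polynomial. -/
def negTerm (N : ℕ) (σ p p' r s M₁ : ℤ) (L₁ : ℚ) (M₂ : ℤ) (L₂ : ℚ) (j : ℤ) : QSeries :=
  qPow ((1 : ℚ) / N * ((p * j + (M₁ - M₂) + r) * (p' * j + s))) *
    ∑ᶠ η : Fin (N - 1) → ℤ, negInner N σ p p' r s M₁ L₁ M₂ L₂ j η

/-- The level-`N` polynomial `X_{r,s,σ}^{(p,p'),N}(M₁, L₁, M₂, L₂)`. -/
def levelX (N : ℕ) (σ p p' r s M₁ : ℤ) (L₁ : ℚ) (M₂ : ℤ) (L₂ : ℚ) : QSeries :=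
  (∑ᶠ j : ℤ, posTerm N σ p p' r s M₁ L₁ M₂ L₂ j) - ∑ᶠ j : ℤ, negTerm N σ p p' r s M₁ L₁ M₂ L₂ j

/-- All sums in the definition of `levelX` have only finitely many non-zero terms. -/
def LevelXFinite (N : ℕ) (σ p p' r s M₁ : ℤ) (L₁ : ℚ) (M₂ : ℤ) (L₂ : ℚ) : Prop :=
  (∀ j, (Function.support (posInner N σ p p' M₁ L₁ M₂ L₂ j)).Finite) ∧
  (∀ j, (Function.support (negInner N σ p p' r s M₁ L₁ M₂ L₂ j)).Finite) ∧
  (Function.support (posTerm N σ p p' r s M₁ L₁ M₂ L₂)).Finite ∧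
  (Function.support (negTerm N σ p p' r s M₁ L₁ M₂ L₂)).Finite

/-! ### The transform -/

open Classical in
/-- The summand of index `n` in the inner sum of the transform:
`q ^ (n C⁻¹ n) [m + n ; n] X_{r,s}^{(p,p')}(i + M₁₂, L₁ - i + m_1/2, i, L₂ - M₁₂ - i + m_1/2)`
with `m + n = (I m + (2 i + M₁₂) e_1) / 2`. For `N = 1` one reads `m_1 = 0`. -/
def transformInner (N : ℕ) (σ p p' r s M₁ : ℤ) (L₁ : ℚ) (M₂ : ℤ) (L₂ : ℚ) (i : ℤ)
    (n : Fin (N - 1) → ℤ) : QSeries :=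
  let a : ℚ := 2 * i + (M₁ - M₂)
  let m₁ : ℚ := component a 0 (solution N a 0 n) 1
  if Restricted N σ (2 * i + (M₁ - M₂)) n then
    weight N a 0 n *
      burgeX p p' r s (i + (M₁ - M₂)) (L₁ - i + m₁ / 2) i (L₂ - (M₁ - M₂) - i + m₁ / 2)
  else 0

/-- The summand of index `i` in the transform. -/
def transformTerm (N : ℕ) (σ p p' r s M₁ : ℤ) (L₁ : ℚ) (M₂ : ℤ) (L₂ : ℚ) (i : ℤ) : QSeries :=
  qPow ((i : ℚ) * (i + (M₁ - M₂)) / N) * qBinom (L₁ + L₂ + M₂ - i) (M₂ - i) *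
    ∑ᶠ n : Fin (N - 1) → ℤ, transformInner N σ p p' r s M₁ L₁ M₂ L₂ i n

/-- The pair of inequalities between integer parts, for given `r` and `s`. -/
def FloorCond (N : ℕ) (p p' r s M₁ : ℤ) (L₁ : ℚ) (M₂ : ℤ) (L₂ : ℚ) : Prop :=
  ⌊(L₁ + (M₁ - M₂) * (N - 1) / (2 * N) - s - r / N) / ((p' : ℚ) + p / N)⌋
      ≤ ⌊(L₁ + (M₁ - M₂) + r - s) / ((p' : ℚ) - p)⌋ ∧
  ⌊(L₂ - (M₁ - M₂) * (N - 1) / (2 * N) + s + r / N) / ((p' : ℚ) + p / N)⌋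
      ≤ ⌊(L₂ - (M₁ - M₂) - r + s) / ((p' : ℚ) - p)⌋

/-- The integer-part inequality of the symmetric case. -/
def FloorCondSymm (N : ℕ) (p p' r s : ℤ) (L : ℚ) : Prop :=
  ⌊(L + s + r / N) / ((p' : ℚ) + p / N)⌋ ≤ ⌊(L - r + s) / ((p' : ℚ) - p)⌋

end

end Burge

open Burge

namespace Burge


/-! ### Monomials and finite sums -/

/-! Expanding Burge's polynomials on the right and exchanging finite sums reduces the theorem to one
identity per product of two binomials. Such a product carries a shift `(c, t)`, equal to `(p j, p'
j)` in the positive part and to `(p j + r, p' j + s)` in the negative part. The corresponding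
level-`N` summand is a sum over `η` with `M₁ + c`, `L₁ - c - t`, `M₂ - c`, `L₂ + c + t` as
parameters, and its power of `q` has the extra exponent `c (c + M₁ - M₂) / N`. What remains is a
generalized `q`-Saalschütz sum (`finsum_levelTerm_eq`), which for `N = 1` is the classical one. The
congruence conditions on `η` and `n` can be dropped: they hold whenever the upper entries of the
binomials are integers.

The generalized sum is proved by summing over `m` instead of `n`. For the sequence `x = (a, m_1, …,
m_{N-1}, b)` the `(m,n)`-system says that `n` is half the second difference of `x`. Hence `n C⁻¹ n`
is `1/4 ∑ (x_j - x_{j+1})²` up to a term in `a - b`, and the binomials become `[(x_j + x_{j+2})/2 ;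
x_{j+1}]`. This weight is local along `x`, so a variable can be split off at either end. Induction
on the length (`polyEta_eq_polyTransform`) splits off the last variable on one side and the first on
the other; the two agree by Sears' transformation (`polyBinom_sears`), itself a double sum evaluated
in both orders by `q`-Saalschütz.

The induction needs no side conditions because the binomials are extended to negative upper entries
as polynomials in `q ^ t`. To return to the standard binomials one uses that a sequence of non-zero
weight is non-negative and convex, hence lies below its chord. Under `Admissible`, either all terms
with standard binomials vanish, or a negative upper entry in one of the two outer binomials forces
the other one to vanish in the extended reading. The inequalities between integer parts provide
`Admissible` for every `j`. -/

theorem qPow_add (a b : ℚ) : qPow (a + b) = qPow a * qPow b := by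
  simp [qPow, HahnSeries.single_mul_single]

theorem qPow_zero : qPow 0 = 1 := rfl

theorem qPow_eq_one_iff {a : ℚ} : qPow a = 1 ↔ a = 0 := by
  constructor
  · intro h
    by_contra ha
    have h1 := congrArg (fun x : QSeries => x.coeff a) h
    simp [qPow, HahnSeries.coeff_one, ha] at h1
  · rintro rfl
    rfl

theorem qPow_mul_eq {a b : ℚ} (h : a = b) (x : QSeries) : qPow a * x = qPow b * x := by
  rw [h]

theorem qPoch_ne_zero (n : ℕ) : qPoch n ≠ 0 := by
  refine Finset.prod_ne_zero_iff.mpr fun k _ h => ?_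
  have : ((k : ℚ) + 1) = 0 := qPow_eq_one_iff.mp (sub_eq_zero.mp h).symm
  exact absurd this (by positivity)

theorem qPoch_succ (n : ℕ) : qPoch (n + 1) = qPoch n * (1 - qPow ((n : ℚ) + 1)) :=
  Finset.prod_range_succ _ _

theorem finsum_swap {α β : Type*} (f : α → β → QSeries)
    (h : {x : α × β | f x.1 x.2 ≠ 0}.Finite) :
    ∑ᶠ a, ∑ᶠ b, f a b = ∑ᶠ b, ∑ᶠ a, f a b := by
  have h' : (Function.support fun x : β × α => f x.2 x.1).Finite := by
    have := h.preimage (Equiv.prodComm β α).injective.injOn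
    exact this
  rw [← finsum_curry (fun x : α × β => f x.1 x.2) h,
    ← finsum_curry (fun x : β × α => f x.2 x.1) h',
    ← finsum_comp_equiv (Equiv.prodComm β α)]
  rfl

theorem finite_of_bounds {P : ℤ → Prop} (a b : ℤ) (h : ∀ i, P i → a ≤ i ∧ i ≤ b) :
    {i | P i}.Finite :=
  (Set.finite_Icc a b).subset fun i hi => h i hi

theorem finite_of_bounds₂ {P : ℤ × ℤ → Prop} (a b c d : ℤ)
    (h : ∀ i j, P (i, j) → (a ≤ i ∧ i ≤ b) ∧ c ≤ j ∧ j ≤ d) : {x | P x}.Finite :=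
  ((Set.finite_Icc a b).prod (Set.finite_Icc c d)).subset fun x hx => h x.1 x.2 hx

/-! ### The `q`-binomial coefficient as a polynomial in `q ^ t` -/

/-- `(1 - q ^ t) (1 - q ^ (t - 1)) ⋯ (1 - q ^ (t - n + 1))`. -/
noncomputable def fallPoch (t : ℤ) (n : ℕ) : QSeries :=
  ∏ k ∈ Finset.range n, (1 - qPow ((t : ℚ) - k))

/-- The `q`-binomial coefficient extended to all integers `t` as a polynomial in `q ^ t`. -/
noncomputable def polyBinom (t b : ℤ) : QSeries :=
  if 0 ≤ b then fallPoch t b.toNat / qPoch b.toNat else 0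

theorem fallPoch_succ (t : ℤ) (n : ℕ) :
    fallPoch t (n + 1) = fallPoch t n * (1 - qPow ((t : ℚ) - n)) :=
  Finset.prod_range_succ _ _

theorem fallPoch_succ' (t : ℤ) (n : ℕ) :
    fallPoch (t + 1) (n + 1) = (1 - qPow ((t : ℚ) + 1)) * fallPoch t n := by
  unfold fallPoch
  rw [Finset.prod_range_succ', mul_comm]
  congr 1
  · push_cast; simp
  · refine Finset.prod_congr rfl fun k _ => ?_
    push_cast
    congr 2
    ring

theorem fallPoch_add (t : ℤ) (m n : ℕ) :
    fallPoch t (m + n) = fallPoch t m * fallPoch (t - m) n := by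
  unfold fallPoch
  rw [Finset.prod_range_add]
  congr 1
  refine Finset.prod_congr rfl fun k _ => ?_
  push_cast
  congr 2
  ring

theorem fallPoch_add_mul_qPoch (m n : ℕ) :
    fallPoch ((m : ℤ) + n) n * qPoch m = qPoch (m + n) := by
  induction n with
  | zero => simp [fallPoch]
  | succ n ih =>
    have h := fallPoch_succ' ((m : ℤ) + n) n
    have e : ((m : ℤ) + (n + 1 : ℕ)) = (m : ℤ) + n + 1 := by push_cast; ring
    rw [e, h, mul_assoc, ih, ← add_assoc, qPoch_succ, mul_comm]
    push_cast
    rfl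

theorem fallPoch_eq_zero {t n : ℕ} (h : t < n) : fallPoch t n = 0 := by
  refine Finset.prod_eq_zero (Finset.mem_range.mpr h) ?_
  simp [qPow_zero]

theorem polyBinom_of_neg {t b : ℤ} (h : b < 0) : polyBinom t b = 0 :=
  if_neg (by omega)

theorem polyBinom_natCast (t : ℤ) (n : ℕ) : polyBinom t n = fallPoch t n / qPoch n := by
  simp [polyBinom]

theorem polyBinom_zero (t : ℤ) : polyBinom t 0 = 1 := by
  simp [polyBinom, fallPoch, qPoch]

theorem polyBinom_of_lt {t b : ℤ} (h0 : 0 ≤ t) (h : t < b) : polyBinom t b = 0 := by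
  lift t to ℕ using h0
  lift b to ℕ using by omega
  rw [polyBinom_natCast, fallPoch_eq_zero (by omega), zero_div]

theorem polyBinom_zero_left {b : ℤ} (h : b ≠ 0) : polyBinom 0 b = 0 := by
  rcases lt_or_gt_of_ne h with h | h
  · exact polyBinom_of_neg h
  · exact polyBinom_of_lt le_rfl h

theorem nonneg_of_polyBinom_ne_zero {t b : ℤ} (h : polyBinom t b ≠ 0) : 0 ≤ b := by
  by_contra hb
  exact h (polyBinom_of_neg (by omega))

theorem le_of_polyBinom_ne_zero {t b : ℤ} (h : polyBinom t b ≠ 0) (ht : 0 ≤ t) : b ≤ t := by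
  by_contra hb
  exact h (polyBinom_of_lt ht (by omega))

theorem polyBinom_pascal (t b : ℤ) :
    polyBinom (t + 1) b = polyBinom t b + qPow ((t : ℚ) + 1 - b) * polyBinom t (b - 1) := by
  rcases lt_trichotomy b 0 with h | rfl | h
  · simp [polyBinom_of_neg h, polyBinom_of_neg (show b - 1 < 0 by omega)]
  · simp [polyBinom_zero, polyBinom_of_neg]
  · obtain ⟨n, rfl⟩ : ∃ n : ℕ, b = (n + 1 : ℕ) := ⟨(b - 1).toNat, by omega⟩
    have e : (((n + 1 : ℕ) : ℤ) - 1) = (n : ℕ) := by push_cast; ring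
    rw [e, polyBinom_natCast, polyBinom_natCast, polyBinom_natCast, fallPoch_succ',
      fallPoch_succ, qPoch_succ]
    have h1 := qPoch_ne_zero n
    have h2 : (1 - qPow ((n : ℚ) + 1)) ≠ 0 := by
      have := qPoch_ne_zero (n + 1)
      rw [qPoch_succ] at this
      exact right_ne_zero_of_mul this
    have h3 : qPow ((t : ℚ) + 1 - ((n + 1 : ℕ) : ℤ)) = qPow ((t : ℚ) - n) := by
      congr 1; push_cast; ring
    have h4 : qPow ((t : ℚ) + 1) = qPow ((t : ℚ) - n) * qPow ((n : ℚ) + 1) := by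
      rw [← qPow_add]; congr 1; ring
    rw [h3, h4]
    field_simp
    ring

/-- For non-negative `x` and `k` both sides are `fallPoch t (x + k) / ((q)_x (q)_k)`. No sign
condition on `t` is needed, which is the purpose of the polynomial extension. -/
theorem polyBinom_mul_polyBinom (t x k : ℤ) :
    polyBinom t (x + k) * polyBinom (x + k) k = polyBinom t x * polyBinom (t - x) k := by
  by_cases hk : 0 ≤ k
  · by_cases hx : 0 ≤ x
    · lift x to ℕ using hx
      lift k to ℕ using hk
      have e : ((x : ℤ) + k) = (x + k : ℕ) := by push_cast; ring
      have h1 := fallPoch_add_mul_qPoch x k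
      rw [polyBinom_natCast, e, polyBinom_natCast, polyBinom_natCast, polyBinom_natCast,
        fallPoch_add, ← h1, ← e]
      have h2 := qPoch_ne_zero (x + k)
      rw [← h1] at h2
      have h3 := left_ne_zero_of_mul h2
      have h4 := right_ne_zero_of_mul h2
      have h5 := qPoch_ne_zero k
      field_simp
    · rw [polyBinom_of_neg (show x < 0 by omega), zero_mul]
      by_cases h : 0 ≤ x + k
      · rw [polyBinom_of_lt h (by omega), mul_zero]
      · rw [polyBinom_of_neg (show x + k < 0 by omega), zero_mul]
  · rw [polyBinom_of_neg (show k < 0 by omega), polyBinom_of_neg (show k < 0 by omega),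
      mul_zero, mul_zero]

theorem polyBinom_add_right (m n : ℕ) :
    polyBinom ((m : ℤ) + n) n = qPoch (m + n) / (qPoch m * qPoch n) := by
  have h := qPoch_ne_zero m
  have h' := qPoch_ne_zero n
  rw [polyBinom_natCast, ← fallPoch_add_mul_qPoch]
  field_simp

theorem polyBinom_symm {t : ℤ} (ht : 0 ≤ t) (b : ℤ) : polyBinom t (t - b) = polyBinom t b := by
  by_cases h0 : 0 ≤ b
  · by_cases h1 : b ≤ t
    · obtain ⟨c, rfl⟩ : ∃ c, t = c + b := ⟨t - b, by ring⟩
      lift b to ℕ using h0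
      lift c to ℕ using by omega
      rw [add_sub_cancel_right, polyBinom_add_right, add_comm (c : ℤ), polyBinom_add_right,
        add_comm, mul_comm (qPoch b)]
    · rw [polyBinom_of_lt (b := b) ht (by omega), polyBinom_of_neg (by omega)]
  · rw [polyBinom_of_neg (b := b) (by omega), polyBinom_of_lt ht (by omega)]

/-! ### Summation formulas -/

theorem vandermonde_term_support {m n k j : ℤ} {c : QSeries}
    (h : c * polyBinom m (k - j) * polyBinom n j ≠ 0) : 0 ≤ j ∧ j ≤ k := by
  have h1 := nonneg_of_polyBinom_ne_zero (right_ne_zero_of_mul h)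
  have h2 := nonneg_of_polyBinom_ne_zero (right_ne_zero_of_mul (left_ne_zero_of_mul h))
  omega

/-- The `q`-Chu-Vandermonde sum. -/
theorem polyBinom_vandermonde (m n k : ℤ) :
    polyBinom (m + n) k = ∑ᶠ j : ℤ, qPow (((n : ℚ) - j) * (k - j)) *
      polyBinom m (k - j) * polyBinom n j := by
  -- Induction on `k = l - 1`, starting from the trivial value `k = -1`. Under `m ↦ m + 1` both
  -- sides change by the same multiple of the identity for `k - 1`.
  have main : ∀ (l : ℕ) (m : ℤ), polyBinom (m + n) ((l : ℤ) - 1) =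
      ∑ᶠ j : ℤ, qPow (((n : ℚ) - j) * (((l : ℤ) - 1 : ℤ) - j)) *
        polyBinom m ((l : ℤ) - 1 - j) * polyBinom n j := by
    intro l
    induction l with
    | zero =>
      intro m
      rw [polyBinom_of_neg (by simp), finsum_eq_zero_of_forall_eq_zero]
      intro j
      by_contra h
      have := vandermonde_term_support h
      omega
    | succ l ih =>
      have e : (((l + 1 : ℕ) : ℤ) - 1) = l := by push_cast; ring
      rw [e]
      have hfin : ∀ m : ℤ, (Function.support fun j : ℤ => qPow (((n : ℚ) - j) * ((l : ℤ) - j)) *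
          polyBinom m ((l : ℤ) - j) * polyBinom n j).Finite := fun m =>
        finite_of_bounds 0 l fun j hj => vandermonde_term_support hj
      have step : ∀ m : ℤ, ∑ᶠ j : ℤ, qPow (((n : ℚ) - j) * ((l : ℤ) - j)) *
          polyBinom (m + 1) ((l : ℤ) - j) * polyBinom n j
          = ∑ᶠ j : ℤ, qPow (((n : ℚ) - j) * ((l : ℤ) - j)) *
          polyBinom m ((l : ℤ) - j) * polyBinom n j
            + qPow ((m : ℚ) + n + 1 - l) * polyBinom (m + n) ((l : ℤ) - 1) := by
        intro m
        rw [ih m, mul_finsum, ← finsum_add_distrib (hfin m)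
          (finite_of_bounds 0 (l - 1) fun j hj =>
            vandermonde_term_support (right_ne_zero_of_mul hj))]
        refine finsum_congr fun j => ?_
        have e1 : qPow (((n : ℚ) - j) * ((l : ℤ) - j)) * qPow ((m : ℚ) + 1 - ((l : ℤ) - j : ℤ))
            = qPow ((m : ℚ) + n + 1 - l) * qPow (((n : ℚ) - j) * (((l : ℤ) - 1 : ℤ) - j)) := by
          rw [← qPow_add, ← qPow_add]; congr 1; push_cast; ring
        rw [polyBinom_pascal, show (l : ℤ) - j - 1 = l - 1 - j by ring]
        linear_combination (polyBinom m ((l : ℤ) - 1 - j) * polyBinom n j) * e1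
      have step' : ∀ m : ℤ, polyBinom (m + 1 + n) l = polyBinom (m + n) l
          + qPow ((m : ℚ) + n + 1 - l) * polyBinom (m + n) ((l : ℤ) - 1) := by
        intro m
        rw [show m + 1 + n = m + n + 1 by ring, polyBinom_pascal]
        push_cast; rfl
      intro m
      induction m using Int.induction_on with
      | zero =>
        rw [finsum_eq_single _ (l : ℤ)]
        · simp [polyBinom_zero, qPow_zero]
        · intro j hj
          rw [polyBinom_zero_left (by omega)]
          simp
      | succ i h => rw [step', h, step]
      -- The increment is known for every integer `m`, so the recursion also runs downwards.
      | pred i h =>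
        have h1 := step (-(i : ℤ) - 1)
        have h2 := step' (-(i : ℤ) - 1)
        rw [sub_add_cancel] at h1 h2
        rw [h2, h1] at h
        exact add_right_cancel h
  by_cases hk : 0 ≤ k
  · have := main (k + 1).toNat m
    rwa [show (((k + 1).toNat : ℕ) : ℤ) - 1 = k by omega] at this
  · rw [polyBinom_of_neg (by omega), finsum_eq_zero_of_forall_eq_zero]
    intro j
    by_contra h
    have := vandermonde_term_support h
    omega

/-- The `q`-Saalschütz sum. -/
theorem polyBinom_saalschutz (A B M M' : ℤ) :
    ∑ᶠ i : ℤ, qPow ((i : ℚ) * (i + M - M')) * polyBinom (A + B + M' - i) (M' - i) *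
      polyBinom A (i + M - M') * polyBinom B i
      = polyBinom (A + M') M * polyBinom (B + M) M' := by
  -- the double sum over `i` and `u`
  set f : ℤ → ℤ → QSeries := fun i u =>
    qPow ((i : ℚ) * (i + M - M') + (u - i) * (B + M - M' + u)) *
      (polyBinom A (u + M - M') * polyBinom (u + M - M') (u - i) *
        polyBinom (B + M) (M' - u) * polyBinom B i) with hf
  have h1 : ∀ i : ℤ, qPow ((i : ℚ) * (i + M - M')) * polyBinom (A + B + M' - i) (M' - i) *
      polyBinom A (i + M - M') * polyBinom B i = ∑ᶠ u, f i u := by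
    intro i
    -- This splitting of the upper entry makes the trinomial revision with `[A ; i + M - M']`
    -- possible and leaves the factor `[B + M ; M' - u]` free of `i`.
    rw [show A + B + M' - i = (B + M) + (A - (i + M - M')) by ring,
      add_comm (B + M), polyBinom_vandermonde, mul_finsum, finsum_mul, finsum_mul]
    conv_lhs => rw [← finsum_comp_equiv (M := QSeries) (Equiv.subLeft M')]
    refine finsum_congr fun u => ?_
    simp only [Equiv.subLeft_apply, hf]
    have e := polyBinom_mul_polyBinom A (i + M - M') (u - i)
    rw [show i + M - M' + (u - i) = u + M - M' by ring] at e
    rw [show M' - i - (M' - u) = u - i by ring, e]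
    rw [qPow_add]
    have e2 : (((B + M : ℤ) : ℚ) - ((M' - u : ℤ) : ℚ)) * (((M' - i : ℤ) : ℚ) - ((M' - u : ℤ) : ℚ))
        = (u - i) * (B + M - M' + u) := by
      push_cast; ring
    rw [e2]
    ring
  have hb : ∀ i u, f i u ≠ 0 → (0 ≤ i ∧ i ≤ M') ∧ 0 ≤ u ∧ u ≤ M' := by
    intro i u h
    have h2 := right_ne_zero_of_mul h
    have h3 := nonneg_of_polyBinom_ne_zero (right_ne_zero_of_mul h2)
    have h4 := nonneg_of_polyBinom_ne_zero (right_ne_zero_of_mul (left_ne_zero_of_mul h2))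
    have h5 := nonneg_of_polyBinom_ne_zero
      (right_ne_zero_of_mul (left_ne_zero_of_mul (left_ne_zero_of_mul h2)))
    omega
  rw [finsum_congr h1, finsum_swap f (finite_of_bounds₂ 0 M' 0 M' hb), polyBinom_vandermonde A M' M,
    finsum_mul]
  conv_rhs => rw [← finsum_comp_equiv (M := QSeries) (Equiv.subLeft M')]
  refine finsum_congr fun u => ?_
  simp only [Equiv.subLeft_apply]
  -- After the exchange the sum over `i` is again a Vandermonde sum.
  have h2 : ∑ᶠ i, f i u = qPow ((u : ℚ) * (u + M - M')) * polyBinom A (u + M - M') *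
      polyBinom (B + M) (M' - u) * polyBinom (u + M - M' + B) u := by
    rw [polyBinom_vandermonde (u + M - M') B u, mul_finsum]
    refine finsum_congr fun i => ?_
    simp only [hf]
    have e : qPow ((i : ℚ) * (i + M - M') + (u - i) * (B + M - M' + u))
        = qPow ((u : ℚ) * (u + M - M')) * qPow (((B : ℚ) - i) * (u - i)) := by
      rw [← qPow_add]; congr 1; ring
    rw [e]
    ring
  rw [h2]
  have e3 := polyBinom_mul_polyBinom (B + M) (M' - u) u
  rw [sub_add_cancel, show B + M - (M' - u) = u + M - M' + B by ring] at e3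
  have e5 : (((M' : ℚ) - ((M' - u : ℤ) : ℚ))) * ((M : ℚ) - ((M' - u : ℤ) : ℚ))
      = (u : ℚ) * (u + M - M') := by push_cast; ring
  rw [mul_assoc, ← e3, e5, show M - (M' - u) = u + M - M' by ring]
  -- The symmetry `[M' ; M' - u] = [M' ; u]` fails for the extended binomial if `M' < 0`; then both
  -- sides contain a binomial with lower entry `M'`, which vanishes.
  by_cases h0 : 0 ≤ M'
  · rw [polyBinom_symm h0 u]
    ring
  · rw [polyBinom_of_neg (show M' < 0 by omega)]
    ring

/-- Sears' transformation of a terminating balanced `₄φ₃` series. -/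
theorem polyBinom_sears (a b c l m n : ℤ) :
    ∑ᶠ i : ℤ, qPow ((i : ℚ) * (i - m + l)) * polyBinom (n + b + i) n *
      polyBinom (a + n + l) (n + l - m + i) * polyBinom (a + l + c + m - i) (m - i) * polyBinom c i
    = ∑ᶠ k : ℤ, qPow ((k : ℚ) * (k - m + l)) * polyBinom (a + b + m + n - k) (n - k) *
      polyBinom (k + l + c) m * polyBinom (a + l + m) (k + l) * polyBinom (b - l + m) k := by
  -- In this double sum, both the sum over `k` and the sum over `i` are `q`-Saalschütz sums; the two
  -- orders give the two sides.
  set f : ℤ → ℤ → QSeries := fun i k =>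
    qPow ((i : ℚ) * (i - m + l) + k * (k + l - m + i)) * polyBinom (a + b + m + n - k) (n - k) *
      polyBinom (a + l) (i + (k + l) - m) * polyBinom (b - l + m) k *
      polyBinom (a + l + c + m - i) (m - i) * polyBinom c i with hf
  have hb : ∀ i k, f i k ≠ 0 → (0 ≤ i ∧ i ≤ m) ∧ 0 ≤ k ∧ k ≤ n := by
    intro i k h
    have h1 := nonneg_of_polyBinom_ne_zero (right_ne_zero_of_mul h)
    have h2 := left_ne_zero_of_mul h
    have h3 := nonneg_of_polyBinom_ne_zero (right_ne_zero_of_mul h2)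
    have h4 := left_ne_zero_of_mul h2
    have h5 := nonneg_of_polyBinom_ne_zero (right_ne_zero_of_mul h4)
    have h6 := nonneg_of_polyBinom_ne_zero
      (right_ne_zero_of_mul (left_ne_zero_of_mul (left_ne_zero_of_mul h4)))
    omega
  have h1 : ∀ i : ℤ, qPow ((i : ℚ) * (i - m + l)) * polyBinom (n + b + i) n *
      polyBinom (a + n + l) (n + l - m + i) * polyBinom (a + l + c + m - i) (m - i) *
      polyBinom c i = ∑ᶠ k, f i k := by
    intro i
    have e := polyBinom_saalschutz (a + l) (b - l + m) (n + l - m + i) n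
    rw [show a + l + n = a + n + l by ring, show b - l + m + (n + l - m + i) = n + b + i by ring]
      at e
    have e' : ∑ᶠ k, f i k = qPow ((i : ℚ) * (i - m + l)) *
        (polyBinom (a + n + l) (n + l - m + i) * polyBinom (n + b + i) n) *
        polyBinom (a + l + c + m - i) (m - i) * polyBinom c i := by
      rw [← e, mul_finsum, finsum_mul, finsum_mul]
      refine finsum_congr fun k => ?_
      simp only [hf]
      rw [qPow_add, show a + l + (b - l + m) + n - k = a + b + m + n - k by ring,
        show k + (n + l - m + i) - n = i + (k + l) - m by ring]
      have e1 : (k : ℚ) * (k + (n + l - m + i : ℤ) - n) = k * (k + l - m + i) := by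
        push_cast; ring
      rw [e1]
      ring
    rw [e']
    ring
  have h2 : ∀ k : ℤ, ∑ᶠ i, f i k = qPow ((k : ℚ) * (k - m + l)) *
      polyBinom (a + b + m + n - k) (n - k) * polyBinom (k + l + c) m *
      polyBinom (a + l + m) (k + l) * polyBinom (b - l + m) k := by
    intro k
    have e := polyBinom_saalschutz (a + l) c (k + l) m
    have e' : ∑ᶠ i, f i k = qPow ((k : ℚ) * (k - m + l)) * polyBinom (a + b + m + n - k) (n - k) *
        polyBinom (b - l + m) k * (polyBinom (a + l + m) (k + l) * polyBinom (c + (k + l)) m) := by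
      rw [← e, mul_finsum]
      refine finsum_congr fun i => ?_
      simp only [hf]
      have e1 : qPow ((i : ℚ) * (i - m + l) + k * (k + l - m + i))
          = qPow ((k : ℚ) * (k - m + l)) * qPow ((i : ℚ) * (i + (k + l : ℤ) - m)) := by
        rw [← qPow_add]; congr 1; push_cast; ring
      rw [e1]
      ring
    rw [e', add_comm c]
    ring
  rw [finsum_congr h1, finsum_swap f (finite_of_bounds₂ 0 m 0 n hb)]
  exact finsum_congr h2


/-! ### Sequences with prescribed end points -/

/-- The sequence `a, v_0, …, v_{d-1}, b, b, …`. -/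
def path {α : Type*} {d : ℕ} (a b : α) (v : Fin d → α) (j : ℕ) : α :=
  if j = 0 then a else if h : j - 1 < d then v ⟨j - 1, h⟩ else b

section path
variable {α : Type*} {d : ℕ} (a b y : α) (v : Fin d → α)

@[simp] theorem path_zero : path a b v 0 = a := rfl

theorem path_succ {j : ℕ} (h : j < d) : path a b v (j + 1) = v ⟨j, h⟩ := by
  simp [path, h]

theorem path_of_lt {j : ℕ} (h : d < j) : path a b v j = b := by
  simp [path, show j ≠ 0 by omega, show ¬ j - 1 < d by omega]

theorem path_cons (j : ℕ) :
    path a b (Fin.cons y v : Fin (d + 1) → α) (j + 1) = path y b v j := by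
  rcases j with _ | j
  · rw [path_succ _ _ _ (Nat.succ_pos d)]
    rfl
  · by_cases h : j < d
    · rw [path_succ _ _ _ (show j + 1 < d + 1 by omega), path_succ _ _ _ h]
      exact Fin.cons_succ (α := fun _ => α) y v ⟨j, h⟩
    · rw [path_of_lt _ _ _ (by omega), path_of_lt _ _ _ (by omega)]

/-- The bound on `j` matters: beyond `d + 1` the sequences continue with different constants, `b`
and `y`. -/
theorem path_snoc {j : ℕ} (hj : j ≤ d + 1) :
    path a b (Fin.snoc v y : Fin (d + 1) → α) j = path a y v j := by
  rcases j with _ | j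
  · rfl
  · rw [path_succ _ _ _ (show j < d + 1 by omega)]
    by_cases h : j < d
    · rw [path_succ _ _ _ h]
      exact Fin.snoc_castSucc (α := fun _ => α) y v ⟨j, h⟩
    · obtain rfl : j = d := by omega
      rw [path_of_lt _ _ _ (by omega)]
      exact Fin.snoc_last (α := fun _ => α) y v

theorem path_rev {j : ℕ} (hj : j ≤ d + 1) :
    path a b (v ∘ Fin.rev) j = path b a v (d + 1 - j) := by
  rcases j with _ | j
  · rw [path_of_lt _ _ _ (show d < d + 1 - 0 by omega)]
    rfl
  · by_cases h : j < d
    · rw [path_succ _ _ _ h, show d + 1 - (j + 1) = (d - 1 - j) + 1 by omega,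
        path_succ _ _ _ (show d - 1 - j < d by omega)]
      simp only [Function.comp_apply]
      congr 1
      ext
      simp only [Fin.val_rev]
      omega
    · obtain rfl : j = d := by omega
      rw [path_of_lt _ _ _ (show j < j + 1 by omega), Nat.sub_self]
      rfl

theorem map_path {β : Type*} (f : α → β) (j : ℕ) :
    f (path a b v j) = path (f a) (f b) (f ∘ v) j := by
  unfold path
  split_ifs <;> rfl

end path

/-- A discretely convex sequence lies below its chord. Comparison with the chord from `0` to `j + 1`
comes first; descending induction then moves the right end point to `n`. -/
theorem convex_le_interpolation (f : ℕ → ℚ) (n : ℕ)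
    (h : ∀ j, j + 2 ≤ n → 2 * f (j + 1) ≤ f j + f (j + 2)) {j : ℕ} (hj : j ≤ n) :
    (n : ℚ) * f j ≤ (n - j) * f 0 + j * f n := by
  have h1 : ∀ j, j + 1 ≤ n → ((j : ℚ) + 1) * f j ≤ f 0 + j * f (j + 1) := by
    intro j
    induction j with
    | zero => intro _; simp
    | succ j ih =>
      intro hj
      have h2 := ih (by omega)
      have h3 := mul_le_mul_of_nonneg_left (h j (by omega)) (show (0 : ℚ) ≤ (j : ℚ) + 1 by positivity)
      push_cast
      linarith
  induction hj using Nat.decreasingInduction with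
  | self => simp
  | of_succ k hk ih =>
    have h2 := h1 k hk
    have hk0 : (0 : ℚ) ≤ k := by positivity
    have h3 := mul_le_mul_of_nonneg_left ih hk0
    have h4 := mul_le_mul_of_nonneg_left h2 (show (0 : ℚ) ≤ n by positivity)
    push_cast at h3
    have h5 : ((k : ℚ) + 1) * (n * f k) ≤ (k + 1) * ((n - k) * f 0 + k * f n) := by linarith
    exact le_of_mul_le_mul_left h5 (by positivity)

/-! ### `q`-binomials with rational upper entry -/

/-- The polynomial `q`-binomial coefficient, set to zero if the upper entry is not an integer. -/
noncomputable def ratBinom (t : ℚ) (b : ℤ) : QSeries :=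
  if t.isInt then polyBinom t.num b else 0

@[simp] theorem ratBinom_intCast (t b : ℤ) : ratBinom t b = polyBinom t b := by
  simp [ratBinom, Rat.isInt]

theorem isInt_eq_true_iff {t : ℚ} : t.isInt = true ↔ ∃ z : ℤ, t = z := by
  constructor
  · intro h
    exact ⟨t.num, ((Rat.den_eq_one_iff t).mp (by simpa [Rat.isInt] using h)).symm⟩
  · rintro ⟨z, rfl⟩
    simp [Rat.isInt]

theorem exists_int_of_ratBinom_ne_zero {t : ℚ} {b : ℤ} (h : ratBinom t b ≠ 0) :
    ∃ z : ℤ, t = z := by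
  by_contra h'
  exact h (if_neg (fun h'' => h' (isInt_eq_true_iff.mp h'')))

theorem ratBinom_of_not_int {t : ℚ} {b : ℤ} (h : ¬ ∃ z : ℤ, t = z) : ratBinom t b = 0 := by
  by_contra h'
  exact h (exists_int_of_ratBinom_ne_zero h')

theorem nonneg_of_ratBinom_ne_zero {t : ℚ} {b : ℤ} (h : ratBinom t b ≠ 0) : 0 ≤ b := by
  obtain ⟨z, rfl⟩ := exists_int_of_ratBinom_ne_zero h
  rw [ratBinom_intCast] at h
  exact nonneg_of_polyBinom_ne_zero h

theorem le_of_ratBinom_ne_zero {t : ℚ} {b : ℤ} (h : ratBinom t b ≠ 0) (ht : 0 ≤ t) :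
    (b : ℚ) ≤ t := by
  obtain ⟨z, rfl⟩ := exists_int_of_ratBinom_ne_zero h
  rw [ratBinom_intCast] at h
  exact_mod_cast le_of_polyBinom_ne_zero h (by exact_mod_cast ht)

/-! ### Weights of sequences -/

/-- The weight of the sequence `x = (a, v_0, …, v_{d-1}, b)`. -/
noncomputable def chainWeight {d : ℕ} (a b : ℤ) (v : Fin d → ℤ) : QSeries :=
  qPow (1 / 4 * ∑ j ∈ Finset.range (d + 1), (((path a b v j : ℤ) : ℚ) - (path a b v (j + 1) : ℤ)) ^ 2) *
    ∏ j ∈ Finset.range d,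
      ratBinom ((((path a b v j : ℤ) : ℚ) + (path a b v (j + 2) : ℤ)) / 2) (path a b v (j + 1))

/-- Locality of the weight: the split-off factor sees the remaining sequence only through its first
interior entry. -/
theorem chainWeight_cons {d : ℕ} (a b y : ℤ) (v : Fin d → ℤ) :
    chainWeight a b (Fin.cons y v : Fin (d + 1) → ℤ) =
      qPow (1 / 4 * ((a : ℚ) - y) ^ 2) * ratBinom (((a : ℚ) + (path y b v 1 : ℤ)) / 2) y *
        chainWeight y b v := by
  unfold chainWeight
  rw [Finset.prod_range_succ', Finset.sum_range_succ']
  simp only [path_cons, path_zero, zero_add]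
  rw [mul_add, qPow_add]
  ring

theorem chainWeight_snoc {d : ℕ} (a b y : ℤ) (v : Fin d → ℤ) :
    chainWeight a b (Fin.snoc v y : Fin (d + 1) → ℤ) =
      chainWeight a y v * (qPow (1 / 4 * ((y : ℚ) - b) ^ 2) *
        ratBinom ((((path a y v d : ℤ) : ℚ) + b) / 2) y) := by
  unfold chainWeight
  rw [Finset.prod_range_succ, Finset.sum_range_succ, mul_add, qPow_add]
  have h1 : ∑ j ∈ Finset.range (d + 1), (((path a b (Fin.snoc v y : Fin (d + 1) → ℤ) j : ℤ) : ℚ) -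
      (path a b (Fin.snoc v y : Fin (d + 1) → ℤ) (j + 1) : ℤ)) ^ 2
      = ∑ j ∈ Finset.range (d + 1), (((path a y v j : ℤ) : ℚ) - (path a y v (j + 1) : ℤ)) ^ 2 := by
    refine Finset.sum_congr rfl fun j hj => ?_
    have := Finset.mem_range.mp hj
    rw [path_snoc _ _ _ _ (by omega), path_snoc _ _ _ _ (by omega)]
  have h2 : ∏ j ∈ Finset.range d, ratBinom ((((path a b (Fin.snoc v y : Fin (d + 1) → ℤ) j : ℤ) : ℚ) +
      (path a b (Fin.snoc v y : Fin (d + 1) → ℤ) (j + 2) : ℤ)) / 2)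
        (path a b (Fin.snoc v y : Fin (d + 1) → ℤ) (j + 1))
      = ∏ j ∈ Finset.range d, ratBinom ((((path a y v j : ℤ) : ℚ) + (path a y v (j + 2) : ℤ)) / 2)
        (path a y v (j + 1)) := by
    refine Finset.prod_congr rfl fun j hj => ?_
    have := Finset.mem_range.mp hj
    rw [path_snoc _ _ _ _ (by omega), path_snoc _ _ _ _ (by omega), path_snoc _ _ _ _ (by omega)]
  rw [h1, h2, path_snoc _ _ _ _ (show d ≤ d + 1 by omega),
    path_snoc _ _ _ _ (show d + 1 ≤ d + 1 by omega), path_of_lt a y v (show d < d + 1 by omega),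
    path_of_lt a b _ (show d + 1 < d + 1 + 1 by omega)]
  ring

theorem chainWeight_rev {d : ℕ} (a b : ℤ) (v : Fin d → ℤ) :
    chainWeight b a (v ∘ Fin.rev) = chainWeight a b v := by
  unfold chainWeight
  congr 1
  · congr 2
    rw [← Finset.sum_range_reflect]
    refine Finset.sum_congr rfl fun j hj => ?_
    have := Finset.mem_range.mp hj
    rw [path_rev _ _ _ (by omega), path_rev _ _ _ (by omega),
      show d + 1 - (d + 1 - 1 - j) = j + 1 by omega,
      show d + 1 - (d + 1 - 1 - j + 1) = j by omega]
    ring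
  · rw [← Finset.prod_range_reflect]
    refine Finset.prod_congr rfl fun j hj => ?_
    have := Finset.mem_range.mp hj
    rw [path_rev _ _ _ (by omega), path_rev _ _ _ (by omega), path_rev _ _ _ (by omega),
      show d + 1 - (d - 1 - j) = j + 2 by omega,
      show d + 1 - (d - 1 - j + 2) = j by omega,
      show d + 1 - (d - 1 - j + 1) = j + 1 by omega, add_comm]

theorem path_nonneg {d : ℕ} {a b : ℤ} {v : Fin d → ℤ} (ha : 0 ≤ a) (hb : 0 ≤ b)
    (h : chainWeight a b v ≠ 0) (j : ℕ) : 0 ≤ path a b v j := by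
  rcases j with _ | j
  · exact ha
  · by_cases hj : j < d
    · exact nonneg_of_ratBinom_ne_zero (Finset.prod_ne_zero_iff.mp (right_ne_zero_of_mul h) j
        (Finset.mem_range.mpr hj))
    · rwa [path_of_lt _ _ _ (by omega)]

/-- A binomial with non-negative upper entry is non-zero only if its lower entry does not exceed the
upper one, which here is the mean of the two neighbours. -/
theorem path_convex {d : ℕ} {a b : ℤ} {v : Fin d → ℤ} (ha : 0 ≤ a) (hb : 0 ≤ b)
    (h : chainWeight a b v ≠ 0) {j : ℕ} (hj : j < d) :
    2 * ((path a b v (j + 1) : ℤ) : ℚ) ≤ (path a b v j : ℤ) + (path a b v (j + 2) : ℤ) := by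
  have h1 := path_nonneg ha hb h j
  have h2 := path_nonneg ha hb h (j + 2)
  have h1' : (0 : ℚ) ≤ (path a b v j : ℤ) := by exact_mod_cast h1
  have h2' : (0 : ℚ) ≤ (path a b v (j + 2) : ℤ) := by exact_mod_cast h2
  have := le_of_ratBinom_ne_zero (Finset.prod_ne_zero_iff.mp (right_ne_zero_of_mul h) j
        (Finset.mem_range.mpr hj)) (by positivity)
  linarith

theorem path_le_interpolation {d : ℕ} {a b : ℤ} {v : Fin d → ℤ} (ha : 0 ≤ a) (hb : 0 ≤ b)
    (h : chainWeight a b v ≠ 0) {j : ℕ} (hj : j ≤ d + 1) :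
    ((d : ℚ) + 1) * (path a b v j : ℤ) ≤ (d + 1 - j) * a + j * b := by
  have := convex_le_interpolation (fun j => ((path a b v j : ℤ) : ℚ)) (d + 1)
    (fun j hj => path_convex ha hb h (by omega)) hj
  simp only [path_zero, path_of_lt a b v (show d < d + 1 by omega)] at this
  push_cast at this
  exact this

theorem path_le_max {d : ℕ} {a b : ℤ} {v : Fin d → ℤ} (ha : 0 ≤ a) (hb : 0 ≤ b)
    (h : chainWeight a b v ≠ 0) (j : ℕ) : path a b v j ≤ max a b := by
  by_cases hj : j ≤ d + 1
  · have h1 := path_le_interpolation ha hb h hj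
    have h2 : (a : ℚ) ≤ (max a b : ℤ) := by exact_mod_cast le_max_left a b
    have h3 : (b : ℚ) ≤ (max a b : ℤ) := by exact_mod_cast le_max_right a b
    have h4 : (j : ℚ) ≤ d + 1 := by exact_mod_cast hj
    have h5 : ((d : ℚ) + 1) * (path a b v j : ℤ) ≤ (d + 1) * (max a b : ℤ) := by
      have h6 := mul_le_mul_of_nonneg_left h2 (sub_nonneg.mpr h4)
      have h7 := mul_le_mul_of_nonneg_left h3 (show (0 : ℚ) ≤ j by positivity)
      linarith
    exact_mod_cast le_of_mul_le_mul_left h5 (by positivity)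
  · rw [path_of_lt _ _ _ (by omega)]
    exact le_max_right a b

theorem chainWeight_mem_pi {d : ℕ} {a b : ℤ} {v : Fin d → ℤ} (ha : 0 ≤ a) (hb : 0 ≤ b)
    (h : chainWeight a b v ≠ 0) {B : ℤ} (hB : max a b ≤ B) :
    v ∈ Set.pi Set.univ fun _ : Fin d => Set.Icc 0 B := by
  intro k _
  have h1 := path_nonneg ha hb h (k.val + 1)
  have h2 := path_le_max ha hb h (k.val + 1)
  rw [path_succ _ _ _ k.isLt] at h1 h2
  exact ⟨h1, h2.trans hB⟩

theorem finite_pi_Icc (d : ℕ) (B : ℤ) :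
    (Set.pi Set.univ fun _ : Fin d => Set.Icc 0 B).Finite :=
  Set.Finite.pi fun _ => Set.finite_Icc 0 B

theorem path_one_le {d : ℕ} {a : ℤ} {v : Fin d → ℤ} (ha : 0 ≤ a)
    (h : chainWeight a 0 v ≠ 0) : 0 ≤ path a 0 v 1 ∧ path a 0 v 1 ≤ a := by
  refine ⟨path_nonneg ha le_rfl h 1, ?_⟩
  simpa [ha] using path_le_max ha le_rfl h 1


/-! ### The generalized `q`-Saalschütz sum for polynomial binomials -/

theorem exists_ne_zero_of_finsum_ne_zero {α : Type*} {f : α → QSeries} (h : ∑ᶠ x, f x ≠ 0) :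
    ∃ x, f x ≠ 0 := by
  by_contra! h'
  exact h (finsum_eq_zero_of_forall_eq_zero h')

theorem ratBinom_congr {t t' : ℚ} {b b' : ℤ} (ht : t = t') (hb : b = b') :
    ratBinom t b = ratBinom t' b' := by
  rw [ht, hb]

/-- Every summand on either side has binomials whose upper entries differ from `a`, `b` and `c` by
integers, so both sides vanish unless all three are integers. -/
theorem ratBinom_sears (a b c : ℚ) (l m n : ℤ) :
    ∑ᶠ i : ℤ, qPow ((i : ℚ) * (i - m + l)) * ratBinom (n + b + i) n *
      ratBinom (a + n + l) (n + l - m + i) * ratBinom (a + l + c + m - i) (m - i) * ratBinom c i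
    = ∑ᶠ k : ℤ, qPow ((k : ℚ) * (k - m + l)) * ratBinom (a + b + m + n - k) (n - k) *
      ratBinom (k + l + c) m * ratBinom (a + l + m) (k + l) * ratBinom (b - l + m) k := by
  by_cases h : (∃ z : ℤ, a = z) ∧ (∃ z : ℤ, b = z) ∧ ∃ z : ℤ, c = z
  · obtain ⟨⟨a, rfl⟩, ⟨b, rfl⟩, ⟨c, rfl⟩⟩ := h
    have := polyBinom_sears a b c l m n
    simp only [← ratBinom_intCast] at this
    push_cast at this
    exact this
  · rw [finsum_eq_zero_of_forall_eq_zero, finsum_eq_zero_of_forall_eq_zero]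
    · intro k
      by_contra h'
      obtain ⟨z1, h1⟩ := exists_int_of_ratBinom_ne_zero (right_ne_zero_of_mul h')
      obtain ⟨z2, h2⟩ := exists_int_of_ratBinom_ne_zero
        (right_ne_zero_of_mul (left_ne_zero_of_mul h'))
      obtain ⟨z3, h3⟩ := exists_int_of_ratBinom_ne_zero
        (right_ne_zero_of_mul (left_ne_zero_of_mul (left_ne_zero_of_mul h')))
      refine h ⟨⟨z2 - l - m, ?_⟩, ⟨z1 + l - m, ?_⟩, ⟨z3 - k - l, ?_⟩⟩ <;> push_cast <;> linarith
    · intro k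
      by_contra h'
      obtain ⟨z1, h1⟩ := exists_int_of_ratBinom_ne_zero (right_ne_zero_of_mul h')
      obtain ⟨z2, h2⟩ := exists_int_of_ratBinom_ne_zero
        (right_ne_zero_of_mul (left_ne_zero_of_mul (left_ne_zero_of_mul h')))
      obtain ⟨z3, h3⟩ := exists_int_of_ratBinom_ne_zero
        (right_ne_zero_of_mul (left_ne_zero_of_mul (left_ne_zero_of_mul (left_ne_zero_of_mul h'))))
      refine h ⟨⟨z2 - n - l, ?_⟩, ⟨z3 - n - k, ?_⟩, ⟨z1, ?_⟩⟩ <;> push_cast <;> linarith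

/-- The summand of `polyEta`. -/
noncomputable def polyEtaTerm {d : ℕ} (M₁ : ℤ) (L₁ : ℚ) (M₂ : ℤ) (L₂ : ℚ) (v : Fin d → ℤ) :
    QSeries :=
  chainWeight M₁ M₂ v * ratBinom (M₁ + L₁ - (M₂ - (path M₁ M₂ v 1 : ℤ)) / 2) M₁ *
    ratBinom (M₂ + L₂ - (M₁ - (path M₁ M₂ v d : ℤ)) / 2) M₂

/-- The single-sum side of the generalized `q`-Saalschütz sum. -/
noncomputable def polyEta (d : ℕ) (M₁ : ℤ) (L₁ : ℚ) (M₂ : ℤ) (L₂ : ℚ) : QSeries :=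
  ∑ᶠ v : Fin d → ℤ, polyEtaTerm M₁ L₁ M₂ L₂ v

/-- The summand of `polyTransform`. -/
noncomputable def polyTransformTerm {d : ℕ} (M₁ : ℤ) (L₁ : ℚ) (M₂ : ℤ) (L₂ : ℚ) (i : ℤ)
    (v : Fin d → ℤ) : QSeries :=
  chainWeight (2 * i + (M₁ - M₂)) 0 v * ratBinom (L₁ + L₂ + M₂ - i) (M₂ - i) *
    ratBinom (L₁ + (M₁ - M₂) + (path (2 * i + (M₁ - M₂)) 0 v 1 : ℤ) / 2) (i + (M₁ - M₂)) *
    ratBinom (L₂ - (M₁ - M₂) + (path (2 * i + (M₁ - M₂)) 0 v 1 : ℤ) / 2) i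

/-- The double-sum side of the generalized `q`-Saalschütz sum. -/
noncomputable def polyTransform (d : ℕ) (M₁ : ℤ) (L₁ : ℚ) (M₂ : ℤ) (L₂ : ℚ) : QSeries :=
  ∑ᶠ i : ℤ, ∑ᶠ v : Fin d → ℤ, polyTransformTerm M₁ L₁ M₂ L₂ i v

/-- Reversal of the sequence. -/
theorem polyEta_swap (d : ℕ) (M₁ : ℤ) (L₁ : ℚ) (M₂ : ℤ) (L₂ : ℚ) :
    polyEta d M₂ L₂ M₁ L₁ = polyEta d M₁ L₁ M₂ L₂ := by
  unfold polyEta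
  rw [← finsum_comp_equiv (M := QSeries) (Fin.revPerm.arrowCongr (Equiv.refl ℤ))]
  refine finsum_congr fun v => ?_
  change polyEtaTerm M₂ L₂ M₁ L₁ (v ∘ Fin.rev) = _
  unfold polyEtaTerm
  rw [chainWeight_rev, path_rev _ _ _ (by omega), path_rev _ _ _ (by omega), Nat.add_sub_cancel,
    Nat.add_sub_cancel_left]
  ring

/-- The shift `i ↦ i + (M₁ - M₂)` exchanges the two outer binomials and fixes the starting point of
the sequence. -/
theorem polyTransform_swap (d : ℕ) (M₁ : ℤ) (L₁ : ℚ) (M₂ : ℤ) (L₂ : ℚ) :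
    polyTransform d M₂ L₂ M₁ L₁ = polyTransform d M₁ L₁ M₂ L₂ := by
  unfold polyTransform
  rw [← finsum_comp_equiv (M := QSeries) (Equiv.addRight (M₁ - M₂))]
  refine finsum_congr fun i => finsum_congr fun v => ?_
  simp only [Equiv.coe_addRight, polyTransformTerm]
  rw [show 2 * (i + (M₁ - M₂)) + (M₂ - M₁) = 2 * i + (M₁ - M₂) by ring,
    show i + (M₁ - M₂) + (M₂ - M₁) = i by ring, show M₁ - (i + (M₁ - M₂)) = M₂ - i by ring,
    show L₂ + L₁ + M₁ - ((i + (M₁ - M₂) : ℤ) : ℚ) = L₁ + L₂ + M₂ - i by push_cast; ring,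
    show (L₂ + (M₂ - M₁) : ℚ) = L₂ - (M₁ - M₂) by ring,
    show (L₁ - (M₂ - M₁) : ℚ) = L₁ + (M₁ - M₂) by ring]
  ring

theorem polyTransformTerm_bounds {d : ℕ} {M₁ : ℤ} {L₁ : ℚ} {M₂ : ℤ} {L₂ : ℚ} {i : ℤ}
    {v : Fin d → ℤ} (h : polyTransformTerm M₁ L₁ M₂ L₂ i v ≠ 0) :
    0 ≤ i ∧ i ≤ M₂ ∧ 0 ≤ i + (M₁ - M₂) ∧
      v ∈ Set.pi Set.univ fun _ : Fin d => Set.Icc 0 (2 * i + (M₁ - M₂)) := by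
  have h1 := nonneg_of_ratBinom_ne_zero (right_ne_zero_of_mul h)
  have h2 := nonneg_of_ratBinom_ne_zero (right_ne_zero_of_mul (left_ne_zero_of_mul h))
  have h3 := nonneg_of_ratBinom_ne_zero
    (right_ne_zero_of_mul (left_ne_zero_of_mul (left_ne_zero_of_mul h)))
  have h4 := left_ne_zero_of_mul (left_ne_zero_of_mul (left_ne_zero_of_mul h))
  have h5 : 0 ≤ 2 * i + (M₁ - M₂) := by omega
  exact ⟨h1, by omega, h2, chainWeight_mem_pi h5 le_rfl h4 (by simp [h5])⟩

theorem polyEta_eq_zero {d : ℕ} {M₁ : ℤ} (L₁ : ℚ) {M₂ : ℤ} (L₂ : ℚ) (h : M₁ < 0 ∨ M₂ < 0) :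
    polyEta d M₁ L₁ M₂ L₂ = 0 := by
  refine finsum_eq_zero_of_forall_eq_zero fun v => ?_
  by_contra h'
  have h1 := nonneg_of_ratBinom_ne_zero (right_ne_zero_of_mul h')
  have h2 := nonneg_of_ratBinom_ne_zero (right_ne_zero_of_mul (left_ne_zero_of_mul h'))
  omega

theorem polyTransform_eq_zero {d : ℕ} {M₁ : ℤ} (L₁ : ℚ) {M₂ : ℤ} (L₂ : ℚ)
    (h : M₁ < 0 ∨ M₂ < 0) : polyTransform d M₁ L₁ M₂ L₂ = 0 := by
  refine finsum_eq_zero_of_forall_eq_zero fun i => finsum_eq_zero_of_forall_eq_zero fun v => ?_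
  by_contra h'
  have := polyTransformTerm_bounds h'
  omega

theorem polyEta_eq_polyTransform_zero (M₁ : ℤ) (L₁ : ℚ) (M₂ : ℤ) (L₂ : ℚ) :
    polyEta 0 M₁ L₁ M₂ L₂ = polyTransform 0 M₁ L₁ M₂ L₂ := by
  unfold polyEta polyTransform
  simp only [finsum_unique]
  have e : ∀ (a b : ℤ) (v : Fin 0 → ℤ),
      chainWeight a b v = qPow (1 / 4 * ((a : ℚ) - b) ^ 2) := by
    intro a b v
    simp [chainWeight, path_of_lt]
  simp only [polyEtaTerm, polyTransformTerm, e, path_zero,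
    path_of_lt _ _ _ (show 0 < 1 by omega), sub_self, zero_div, sub_zero, add_zero, Int.cast_zero]
  by_cases h : (∃ z : ℤ, L₁ = z) ∧ ∃ z : ℤ, L₂ = z
  · obtain ⟨⟨a, rfl⟩, ⟨b, rfl⟩⟩ := h
    -- The sequence has no interior entry, and the identity is the `q`-Saalschütz sum itself.
    have h1 := polyBinom_saalschutz (a + (M₁ - M₂)) (b - (M₁ - M₂)) M₁ M₂
    rw [show a + (M₁ - M₂) + M₂ = M₁ + a by ring, show b - (M₁ - M₂) + M₁ = M₂ + b by ring] at h1
    simp only [← ratBinom_intCast] at h1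
    push_cast at h1
    rw [mul_assoc, ← h1, mul_finsum]
    refine finsum_congr fun i => ?_
    have e1 : qPow (1 / 4 * ((2 * i + (M₁ - M₂) : ℤ) : ℚ) ^ 2)
        = qPow (1 / 4 * ((M₁ : ℚ) - M₂) ^ 2) * qPow ((i : ℚ) * (i + M₁ - M₂)) := by
      rw [← qPow_add]; congr 1; push_cast; ring
    rw [e1, show i + (M₁ - M₂) = i + M₁ - M₂ by ring,
      show ((a : ℚ) + (M₁ - M₂) + (b - (M₁ - M₂)) + M₂ - i) = a + b + M₂ - i by ring]
    ring
  · rw [finsum_eq_zero_of_forall_eq_zero]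
    · by_contra h'
      obtain ⟨z1, h1⟩ := exists_int_of_ratBinom_ne_zero (right_ne_zero_of_mul h')
      obtain ⟨z2, h2⟩ := exists_int_of_ratBinom_ne_zero
        (right_ne_zero_of_mul (left_ne_zero_of_mul h'))
      refine h ⟨⟨z2 - M₁, ?_⟩, ⟨z1 - M₂, ?_⟩⟩ <;> push_cast <;> linarith
    · intro i
      by_contra h'
      obtain ⟨z1, h1⟩ := exists_int_of_ratBinom_ne_zero (right_ne_zero_of_mul h')
      obtain ⟨z2, h2⟩ := exists_int_of_ratBinom_ne_zero
        (right_ne_zero_of_mul (left_ne_zero_of_mul h'))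
      refine h ⟨⟨z2 - (M₁ - M₂), ?_⟩, ⟨z1 + (M₁ - M₂), ?_⟩⟩ <;> push_cast <;> linarith

theorem finite_support_polyEtaTerm (d : ℕ) {M₁ : ℤ} (L₁ : ℚ) {M₂ : ℤ} (L₂ : ℚ)
    (h₁ : 0 ≤ M₁) (h₂ : 0 ≤ M₂) :
    (Function.support (polyEtaTerm (d := d) M₁ L₁ M₂ L₂)).Finite :=
  (finite_pi_Icc d (max M₁ M₂)).subset fun _ hv => chainWeight_mem_pi h₁ h₂
    (left_ne_zero_of_mul (left_ne_zero_of_mul hv)) le_rfl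

/-- Splitting off the last variable. -/
theorem polyEta_succ (d : ℕ) {M₁ : ℤ} (L₁ : ℚ) {M₂ : ℤ} (L₂ : ℚ)
    (h₁ : 0 ≤ M₁) (h₂ : 0 ≤ M₂) :
    polyEta (d + 1) M₁ L₁ M₂ L₂ = ∑ᶠ y : ℤ, qPow (1 / 4 * ((y : ℚ) - M₂) ^ 2) *
      ratBinom (M₂ + L₂ - (M₁ - y) / 2) M₂ *
        polyEta d M₁ (L₁ - (M₂ - y) / 2) y ((M₁ + M₂) / 2 - y) := by
  unfold polyEta
  rw [← finsum_comp_equiv (M := QSeries) (Fin.snocEquiv fun _ : Fin (d + 1) => ℤ), finsum_curry]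
  · refine finsum_congr fun y => ?_
    rw [mul_finsum]
    refine finsum_congr fun v => ?_
    change polyEtaTerm M₁ L₁ M₂ L₂ (Fin.snoc v y : Fin (d + 1) → ℤ) = _
    unfold polyEtaTerm
    rw [chainWeight_snoc, path_snoc _ _ _ _ (by omega), path_snoc _ _ _ _ (by omega),
      path_of_lt M₁ y v (show d < d + 1 by omega),
      show (M₁ : ℚ) + (L₁ - (M₂ - y) / 2) - (y - (path M₁ y v 1 : ℤ)) / 2
        = M₁ + L₁ - (M₂ - (path M₁ y v 1 : ℤ)) / 2 by ring,
      show (y : ℚ) + ((M₁ + M₂) / 2 - y) - (M₁ - (path M₁ y v d : ℤ)) / 2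
        = ((path M₁ y v d : ℤ) + M₂) / 2 by ring]
    ring
  · exact (finite_support_polyEtaTerm (d + 1) L₁ L₂ h₁ h₂).preimage
      (Fin.snocEquiv fun _ : Fin (d + 1) => ℤ).injective.injOn

/-- The summand of the double-sum side, with its first variable split off. -/
noncomputable def splitTerm {d : ℕ} (M₁ : ℤ) (L₁ : ℚ) (M₂ : ℤ) (L₂ : ℚ) (k m : ℤ)
    (v : Fin d → ℤ) : QSeries :=
  chainWeight m 0 v * (qPow (1 / 4 * ((2 * k + (M₁ - M₂) : ℚ) - m) ^ 2) *
    ratBinom (L₁ + L₂ + M₂ - k) (M₂ - k) *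
    ratBinom (((2 * k + (M₁ - M₂) : ℚ) + (path m 0 v 1 : ℤ)) / 2) m *
    ratBinom (L₁ + (M₁ - M₂) + m / 2) (k + (M₁ - M₂)) *
    ratBinom (L₂ - (M₁ - M₂) + m / 2) k)

theorem polyTransformTerm_cons {d : ℕ} (M₁ : ℤ) (L₁ : ℚ) (M₂ : ℤ) (L₂ : ℚ) (k m : ℤ)
    (v : Fin d → ℤ) : polyTransformTerm M₁ L₁ M₂ L₂ k (Fin.cons m v : Fin (d + 1) → ℤ)
      = splitTerm M₁ L₁ M₂ L₂ k m v := by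
  unfold polyTransformTerm splitTerm
  have e : path (2 * k + (M₁ - M₂)) 0 (Fin.cons m v : Fin (d + 1) → ℤ) 1 = m := path_cons _ _ _ _ 0
  rw [chainWeight_cons, e]
  push_cast
  ring

theorem splitTerm_bounds {d : ℕ} {M₁ : ℤ} {L₁ : ℚ} {M₂ : ℤ} {L₂ : ℚ} {k m : ℤ}
    {v : Fin d → ℤ} (h : splitTerm M₁ L₁ M₂ L₂ k m v ≠ 0) :
    k ∈ Set.Icc 0 M₂ ∧ m ∈ Set.Icc 0 (M₁ + M₂) ∧
      v ∈ Set.pi Set.univ fun _ : Fin d => Set.Icc 0 (M₁ + M₂) := by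
  have h0 := h
  rw [← polyTransformTerm_cons] at h0
  obtain ⟨h1, h2, h3, h4⟩ := polyTransformTerm_bounds h0
  have h5 := h4 0 trivial
  simp only [Fin.cons_zero, Set.mem_Icc] at h5
  refine ⟨⟨h1, h2⟩, ⟨h5.1, by omega⟩, fun j _ => ?_⟩
  have h6 := h4 j.succ trivial
  simp only [Fin.cons_succ, Set.mem_Icc] at h6
  exact ⟨h6.1, by omega⟩

/-- Once the first interior entry `m` is split off, the remaining weight runs from `m` to `0` and is
independent of `k`, so the sum over `k` can be taken innermost. -/
theorem polyTransform_succ (d : ℕ) (M₁ : ℤ) (L₁ : ℚ) (M₂ : ℤ) (L₂ : ℚ) :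
    polyTransform (d + 1) M₁ L₁ M₂ L₂ =
      ∑ᶠ m : ℤ, ∑ᶠ v : Fin d → ℤ, ∑ᶠ k : ℤ, splitTerm M₁ L₁ M₂ L₂ k m v := by
  have h1 : polyTransform (d + 1) M₁ L₁ M₂ L₂ =
      ∑ᶠ k : ℤ, ∑ᶠ x : ℤ × (Fin d → ℤ), splitTerm M₁ L₁ M₂ L₂ k x.1 x.2 := by
    refine finsum_congr fun k => ?_
    rw [← finsum_comp_equiv (M := QSeries) (Fin.consEquiv fun _ : Fin (d + 1) => ℤ)]
    exact finsum_congr fun x => polyTransformTerm_cons M₁ L₁ M₂ L₂ k x.1 x.2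
  rw [h1, finsum_swap, finsum_curry]
  · refine ((Set.finite_Icc 0 (M₁ + M₂)).prod (finite_pi_Icc d (M₁ + M₂))).subset ?_
    intro x hx
    obtain ⟨k, hk⟩ := exists_ne_zero_of_finsum_ne_zero hx
    exact (splitTerm_bounds hk).2
  · exact ((Set.finite_Icc 0 M₂).prod ((Set.finite_Icc 0 (M₁ + M₂)).prod
      (finite_pi_Icc d (M₁ + M₂)))).subset fun x hx => splitTerm_bounds hx

/-- Splitting off the last entry `y` and applying the induction hypothesis to the end points `M₁`,
`y` gives sequences from `2 i + M₁ - y` to `0`. With `m = M₁ + 2 i - y` these are the sequences left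
over on the other side, and for each of them the sums over `i` and `k` agree by Sears. The order of
`M₁` and `M₂` serves only to make the sum over `y` finite. -/
theorem polyEta_eq_polyTransform_succ {d : ℕ}
    (ih : ∀ (M₁ : ℤ) (L₁ : ℚ) (M₂ : ℤ) (L₂ : ℚ),
      polyEta d M₁ L₁ M₂ L₂ = polyTransform d M₁ L₁ M₂ L₂)
    {M₁ : ℤ} (L₁ : ℚ) {M₂ : ℤ} (L₂ : ℚ) (h₁ : 0 ≤ M₁) (h₁₂ : M₁ ≤ M₂) :
    polyEta (d + 1) M₁ L₁ M₂ L₂ = polyTransform (d + 1) M₁ L₁ M₂ L₂ := by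
  set T : ℤ → ℤ → (Fin d → ℤ) → QSeries := fun y i v =>
    qPow (1 / 4 * ((y : ℚ) - M₂) ^ 2) * ratBinom (M₂ + L₂ - (M₁ - y) / 2) M₂ *
      polyTransformTerm M₁ (L₁ - (M₂ - y) / 2) y ((M₁ + M₂) / 2 - y) i v with hT
  have hb : ∀ y i v, T y i v ≠ 0 → (0 ≤ y ∧ y ≤ M₂) ∧ (0 ≤ i ∧ i ≤ M₂) ∧
      v ∈ Set.pi Set.univ fun _ : Fin d => Set.Icc 0 (2 * i + (M₁ - y)) := by
    intro y i v h
    have h0 := right_ne_zero_of_mul h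
    obtain ⟨a1, a2, a3, a4⟩ := polyTransformTerm_bounds h0
    have a5 : 0 ≤ 2 * i + (M₁ - y) := by omega
    obtain ⟨a6, a7⟩ := path_one_le a5
      (left_ne_zero_of_mul (left_ne_zero_of_mul (left_ne_zero_of_mul h0)))
    have a6' : (0 : ℚ) ≤ (path (2 * i + (M₁ - y)) 0 v 1 : ℤ) := by exact_mod_cast a6
    have a7' : ((path (2 * i + (M₁ - y)) 0 v 1 : ℤ) : ℚ) ≤ 2 * i + (M₁ - y) := by exact_mod_cast a7
    have h12 : (M₁ : ℚ) ≤ M₂ := by exact_mod_cast h₁₂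
    -- The upper entry is `(M₂ - M₁ + x_1) / 2`, non-negative because `M₁ ≤ M₂`. Together with `x_1
    -- ≤ 2 i + M₁ - y` the inequality `i ≤ (M₂ - M₁ + x_1) / 2` yields `y ≤ M₂`.
    have a8 := le_of_ratBinom_ne_zero (right_ne_zero_of_mul h0) (by linarith)
    have a9 : (y : ℚ) ≤ M₂ := by linarith
    have a10 : y ≤ M₂ := by exact_mod_cast a9
    exact ⟨⟨by omega, a10⟩, ⟨a1, by omega⟩, a4⟩
  have hb2 : ∀ y i, ∑ᶠ v, T y i v ≠ 0 → (0 ≤ y ∧ y ≤ M₂) ∧ (0 ≤ i ∧ i ≤ M₂) := by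
    intro y i h
    obtain ⟨v, hv⟩ := exists_ne_zero_of_finsum_ne_zero h
    exact ⟨(hb y i v hv).1, (hb y i v hv).2.1⟩
  have e1 : polyEta (d + 1) M₁ L₁ M₂ L₂ = ∑ᶠ y : ℤ, ∑ᶠ i : ℤ, ∑ᶠ v, T y i v := by
    rw [polyEta_succ d L₁ L₂ h₁ (h₁.trans h₁₂)]
    refine finsum_congr fun y => ?_
    rw [ih, polyTransform, mul_finsum]
    exact finsum_congr fun i => mul_finsum _ _
  have e2 : ∑ᶠ y : ℤ, ∑ᶠ i : ℤ, ∑ᶠ v, T y i v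
      = ∑ᶠ m : ℤ, ∑ᶠ i : ℤ, ∑ᶠ v, T (M₁ + 2 * i - m) i v := by
    rw [finsum_swap _ (finite_of_bounds₂ 0 M₂ 0 M₂ hb2)]
    have : ∀ i : ℤ, ∑ᶠ y, ∑ᶠ v, T y i v = ∑ᶠ m, ∑ᶠ v, T (M₁ + 2 * i - m) i v := by
      intro i
      exact (finsum_comp_equiv (M := QSeries) (Equiv.subLeft (M₁ + 2 * i))).symm
    rw [finsum_congr this, finsum_swap]
    refine finite_of_bounds₂ 0 M₂ (-M₂) (M₁ + 2 * M₂) fun i m h => ?_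
    have := hb2 _ _ h
    omega
  rw [e1, e2, polyTransform_succ]
  refine finsum_congr fun m => ?_
  rw [finsum_swap]
  · refine finsum_congr fun v => ?_
    -- Here `m` and the rest `v` of the sequence are fixed, and `c` is half the difference of its
    -- first entry after `m` and `M₁ - M₂`. The common prefactor is `q ^ ((M₁ - M₂ - m)² / 4)`.
    have hs := ratBinom_sears (L₁ - m / 2) (L₂ - m / 2)
      (((path m 0 v 1 : ℤ) - (M₁ - M₂)) / 2) (M₁ - M₂) m M₂
    have hs' := congrArg (fun x => chainWeight m 0 v *
      (qPow (1 / 4 * ((M₁ - M₂ : ℚ) - m) ^ 2) * x)) hs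
    simp only [mul_finsum] at hs'
    refine Eq.trans (finsum_congr fun i => ?_) (hs'.trans (finsum_congr fun k => ?_))
    · simp only [hT, polyTransformTerm]
      have x1 : 2 * i + (M₁ - (M₁ + 2 * i - m)) = m := by ring
      rw [x1, ratBinom_congr (b' := M₂)
          (show (M₂ : ℚ) + L₂ - (M₁ - (M₁ + 2 * i - m : ℤ)) / 2 = M₂ + (L₂ - m / 2) + i by
            push_cast; ring) rfl,
        ratBinom_congr (t' := L₁ - m / 2 + M₂ + (M₁ - M₂ : ℤ)) (b' := M₂ + (M₁ - M₂) - m + i)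
          (by push_cast; ring) (show M₁ + 2 * i - m - i = _ by ring),
        ratBinom_congr (b' := m - i)
          (t' := L₁ - m / 2 + (M₁ - M₂ : ℤ) + ((path m 0 v 1 : ℤ) - (M₁ - M₂)) / 2 + m - i)
          (by push_cast; ring) (show i + (M₁ - (M₁ + 2 * i - m)) = _ by ring),
        ratBinom_congr (t' := ((path m 0 v 1 : ℤ) - (M₁ - M₂)) / 2) (b' := i)
          (by push_cast; ring) rfl,
        show qPow (1 / 4 * (((M₁ + 2 * i - m : ℤ) : ℚ) - M₂) ^ 2)
            = qPow (1 / 4 * ((M₁ - M₂ : ℚ) - m) ^ 2) * qPow ((i : ℚ) * (i - m + (M₁ - M₂ : ℤ))) by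
          rw [← qPow_add]; congr 1; push_cast; ring]
      ring
    · simp only [splitTerm]
      rw [show qPow (1 / 4 * ((2 * k + (M₁ - M₂) : ℚ) - m) ^ 2)
            = qPow (1 / 4 * ((M₁ - M₂ : ℚ) - m) ^ 2) * qPow ((k : ℚ) * (k - m + (M₁ - M₂ : ℤ))) by
          rw [← qPow_add]; congr 1; push_cast; ring,
        ratBinom_congr (t := L₁ - m / 2 + (L₂ - m / 2) + m + M₂ - k) (t' := L₁ + L₂ + M₂ - k)
          (b' := M₂ - k) (by ring) rfl,
        ratBinom_congr (t := k + (M₁ - M₂ : ℤ) + ((path m 0 v 1 : ℤ) - (M₁ - M₂)) / 2)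
          (t' := ((2 * k + (M₁ - M₂) : ℚ) + (path m 0 v 1 : ℤ)) / 2)
          (b' := m) (by push_cast; ring) rfl,
        ratBinom_congr (t := L₁ - m / 2 + (M₁ - M₂ : ℤ) + m)
          (t' := L₁ + (M₁ - M₂) + m / 2) (b' := k + (M₁ - M₂)) (by push_cast; ring) rfl,
        ratBinom_congr (t := L₂ - m / 2 - (M₁ - M₂ : ℤ) + m)
          (t' := L₂ - (M₁ - M₂) + m / 2) (b' := k) (by push_cast; ring) rfl]
      ring
  · refine ((Set.finite_Icc 0 M₂).prod (finite_pi_Icc d m)).subset fun x hx => ?_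
    obtain ⟨_, h2, h3⟩ := hb _ _ _ hx
    refine ⟨h2, ?_⟩
    rwa [show 2 * x.1 + (M₁ - (M₁ + 2 * x.1 - m)) = m by ring] at h3

/-- The generalized `q`-Saalschütz sum. -/
theorem polyEta_eq_polyTransform (d : ℕ) (M₁ : ℤ) (L₁ : ℚ) (M₂ : ℤ) (L₂ : ℚ) :
    polyEta d M₁ L₁ M₂ L₂ = polyTransform d M₁ L₁ M₂ L₂ := by
  induction d generalizing M₁ L₁ M₂ L₂ with
  | zero => exact polyEta_eq_polyTransform_zero M₁ L₁ M₂ L₂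
  | succ d ih =>
    by_cases h : M₁ < 0 ∨ M₂ < 0
    · rw [polyEta_eq_zero L₁ L₂ h, polyTransform_eq_zero L₁ L₂ h]
    · rcases le_total M₁ M₂ with h' | h'
      · exact polyEta_eq_polyTransform_succ ih L₁ L₂ (by omega) h'
      · rw [← polyEta_swap, ← polyTransform_swap]
        exact polyEta_eq_polyTransform_succ ih L₂ L₁ (by omega) h'


/-! ### The `q`-binomials of the statement -/

theorem qBinom_intCast (t b : ℤ) :
    qBinom t b = if 0 ≤ b ∧ b ≤ t then polyBinom t b else 0 := by
  unfold qBinom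
  have h1 : (t : ℚ).isInt = true := by simp [Rat.isInt]
  have h2 : (b : ℚ).isInt = true := by simp [Rat.isInt]
  simp only [h1, h2, true_and, Int.cast_nonneg_iff, Int.cast_le]
  split_ifs with h
  · obtain ⟨n, rfl⟩ : ∃ n, t = n + b := ⟨t - b, by ring⟩
    obtain ⟨h3, h4⟩ := h
    lift b to ℕ using h3
    lift n to ℕ using by omega
    rw [polyBinom_add_right]
    have e1 : (((n : ℤ) + b : ℤ) : ℚ).num.toNat = n + b := by
      rw [Rat.num_intCast]; omega
    have e2 : ((((n : ℤ) + b : ℤ) : ℚ) - ((b : ℤ) : ℚ)).num.toNat = n := by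
      rw [← Int.cast_sub, Rat.num_intCast]; omega
    have e3 : (((b : ℤ) : ℚ)).num.toNat = b := by
      rw [Rat.num_intCast]; omega
    rw [e1, e2, e3, mul_comm (qPoch b)]
  · rfl

theorem exists_int_of_qBinom_ne_zero {t b : ℚ} (h : qBinom t b ≠ 0) :
    ∃ z w : ℤ, t = z ∧ b = w ∧ 0 ≤ w ∧ w ≤ z := by
  unfold qBinom at h
  split_ifs at h with h'
  · obtain ⟨h1, h2, h3, h4⟩ := h'
    obtain ⟨z, rfl⟩ := isInt_eq_true_iff.mp h1
    obtain ⟨w, rfl⟩ := isInt_eq_true_iff.mp h2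
    exact ⟨z, w, rfl, rfl, by exact_mod_cast h3, by exact_mod_cast h4⟩
  · exact absurd rfl h

theorem bounds_of_qBinom_ne_zero {t b : ℚ} (h : qBinom t b ≠ 0) : 0 ≤ b ∧ b ≤ t := by
  obtain ⟨z, w, rfl, rfl, h1, h2⟩ := exists_int_of_qBinom_ne_zero h
  exact ⟨by exact_mod_cast h1, by exact_mod_cast h2⟩

theorem qBinom_of_neg {t b : ℚ} (h : t < 0) : qBinom t b = 0 := by
  by_contra h'
  have := bounds_of_qBinom_ne_zero h'
  linarith

theorem qBinom_of_neg_right {t b : ℚ} (h : b < 0) : qBinom t b = 0 := by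
  by_contra h'
  have := bounds_of_qBinom_ne_zero h'
  linarith

/-- For a non-negative integer upper entry the polynomial extension vanishes by itself when the
lower entry is too large; the two readings can differ only for a negative upper entry. -/
theorem qBinom_eq_ratBinom {t : ℚ} (b : ℤ) (ht : 0 ≤ t) : qBinom t b = ratBinom t b := by
  by_cases h : ∃ z : ℤ, t = z
  · obtain ⟨z, rfl⟩ := h
    have hz : 0 ≤ z := by exact_mod_cast ht
    rw [qBinom_intCast, ratBinom_intCast]
    split_ifs with h'
    · rfl
    · by_cases hb : 0 ≤ b
      · rw [polyBinom_of_lt hz (by omega)]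
      · rw [polyBinom_of_neg (by omega)]
  · rw [ratBinom_of_not_int h]
    by_contra h'
    obtain ⟨z, _, h1, _⟩ := exists_int_of_qBinom_ne_zero h'
    exact h ⟨z, h1⟩

theorem qBinom_symm (t b : ℚ) : qBinom t (t - b) = qBinom t b := by
  by_cases h : (∃ z : ℤ, t = z) ∧ ∃ w : ℤ, b = w
  · obtain ⟨⟨z, rfl⟩, ⟨w, rfl⟩⟩ := h
    rcases lt_or_ge z 0 with hz | hz
    · rw [qBinom_of_neg (by exact_mod_cast hz), qBinom_of_neg (by exact_mod_cast hz)]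
    · have hz' : (0 : ℚ) ≤ z := by exact_mod_cast hz
      rw [← Int.cast_sub, qBinom_eq_ratBinom _ hz', qBinom_eq_ratBinom _ hz', ratBinom_intCast,
        ratBinom_intCast, polyBinom_symm hz]
  · have h1 : qBinom t b = 0 := by
      by_contra h'
      obtain ⟨z, w, h1, h2, _⟩ := exists_int_of_qBinom_ne_zero h'
      exact h ⟨⟨z, h1⟩, ⟨w, h2⟩⟩
    have h2 : qBinom t (t - b) = 0 := by
      by_contra h'
      obtain ⟨z, w, h1, h2, _⟩ := exists_int_of_qBinom_ne_zero h'
      exact h ⟨⟨z, h1⟩, ⟨z - w, by push_cast; linarith⟩⟩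
    rw [h1, h2]

/-! ### The Cartan matrix and the `(m,n)`-system -/

theorem component_eq_path {N : ℕ} (a b : ℚ) (v : Fin (N - 1) → ℚ) (j : ℕ) :
    component a b v j = path a b v j := by
  unfold component path
  rcases j with _ | j
  · simp
  · by_cases h : j < N - 1
    · rw [dif_pos (by omega), if_neg (by omega), dif_pos (by omega)]
    · rw [dif_neg (by omega), if_neg (by omega), if_neg (by omega), dif_neg (by omega)]

theorem cartan_mulVec (N : ℕ) (m : Fin (N - 1) → ℚ) (k : Fin (N - 1)) :
    (cartan N *ᵥ m) k = 2 * m k - path 0 0 m k.val - path 0 0 m (k.val + 2) := by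
  unfold cartan
  obtain ⟨d, hd⟩ : ∃ d, N - 1 = d := ⟨_, rfl⟩
  revert m k
  rw [hd]
  intro m k
  have hm : ∀ j : Fin d, m j = path 0 0 m (j.val + 1) := fun j => (path_succ 0 0 m j.isLt).symm
  simp only [Matrix.mulVec, dotProduct, Matrix.map_apply, CartanMatrix.A, Matrix.of_apply]
  obtain ⟨k, hk⟩ := k
  set x := path 0 0 m with hx
  have e : ∀ j : Fin d, (((if (⟨k, hk⟩ : Fin d) = j then (2 : ℤ)
      else if k + 1 = j.val ∨ j.val + 1 = k then -1 else 0 : ℤ) : ℚ)) * m j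
      = (if k = j.val then 2 * x (j.val + 1) else 0)
        - (if k + 1 = j.val then x (j.val + 1) else 0)
        - (if j.val + 1 = k then x (j.val + 1) else 0) := by
    intro j
    rw [hm j]
    simp only [Fin.ext_iff]
    split_ifs <;> first | omega | simp
  simp only [e]
  rw [Fin.sum_univ_eq_sum_range (fun j => (if k = j then 2 * x (j + 1) else 0)
        - (if k + 1 = j then x (j + 1) else 0)
        - (if j + 1 = k then x (j + 1) else 0)) d,
    Finset.sum_sub_distrib, Finset.sum_sub_distrib, Finset.sum_ite_eq, Finset.sum_ite_eq]
  have h3 : ∑ j ∈ Finset.range d, (if j + 1 = k then x (j + 1) else 0) = x k := by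
    rcases k with _ | k
    · simp [hx]
    · simp only [add_left_inj]
      rw [Finset.sum_ite_eq', if_pos (Finset.mem_range.mpr (by omega))]
  have h2 : (if k + 1 ∈ Finset.range d then x (k + 1 + 1) else 0) = x (k + 2) := by
    by_cases hk' : k + 1 < d
    · rw [if_pos (Finset.mem_range.mpr hk')]
    · rw [if_neg (by simpa using hk'), hx, path_of_lt _ _ _ (by omega)]
  rw [h3, h2, if_pos (Finset.mem_range.mpr hk), hm ⟨k, hk⟩]
  ring

theorem path_eq_path_zero_add_source {N : ℕ} (a b : ℚ) (m : Fin (N - 1) → ℚ) (k : Fin (N - 1)) :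
    path a b m k.val + path a b m (k.val + 2)
      = path 0 0 m k.val + path 0 0 m (k.val + 2) + source N a b k := by
  obtain ⟨k, hk⟩ := k
  have h1 : path a b m k = path 0 0 m k + if k = 0 then a else 0 := by
    rcases k with _ | k
    · simp
    · rw [path_succ _ _ _ (by omega), path_succ _ _ _ (by omega)]
      simp
  have h2 : path a b m (k + 2) = path 0 0 m (k + 2) + if k + 2 = N then b else 0 := by
    by_cases h : k + 1 < N - 1
    · rw [path_succ _ _ _ h, path_succ _ _ _ h, if_neg (by omega), add_zero]
    · rw [path_of_lt _ _ _ (by omega), path_of_lt _ _ _ (by omega), if_pos (by omega), zero_add]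
  simp only [source]
  rw [h1, h2]
  ring

/-- The system as a recurrence: the source term is absorbed by prescribing `a` and `b` as boundary
values. -/
theorem eq_solution_iff {N : ℕ} (a b : ℚ) (n : Fin (N - 1) → ℤ) (m : Fin (N - 1) → ℚ) :
    m = solution N a b n ↔
      ∀ k : Fin (N - 1), m k + n k = (path a b m k.val + path a b m (k.val + 2)) / 2 := by
  rw [← solution_unique, funext_iff]
  refine forall_congr' fun k => ?_
  rw [path_eq_path_zero_add_source]
  simp only [Pi.add_apply, Pi.smul_apply, Matrix.sub_mulVec, Pi.sub_apply, cartan_mulVec,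
    Matrix.smul_mulVec, Matrix.one_mulVec, smul_eq_mul, toRat]
  constructor <;> intro h <;> linarith

theorem solution_add (N : ℕ) (a b : ℚ) (n : Fin (N - 1) → ℤ) (k : Fin (N - 1)) :
    solution N a b n k + n k = (path a b (solution N a b n) k.val +
      path a b (solution N a b n) (k.val + 2)) / 2 :=
  (eq_solution_iff a b n _).mp rfl k

theorem solution_injective (N : ℕ) (a b : ℚ) : Function.Injective (solution N a b) := by
  intro n n' h
  funext k
  have h1 := solution_add N a b n k
  rw [h, ← solution_add N a b n' k] at h1
  exact_mod_cast add_left_cancel h1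

theorem solution_zero {N : ℕ} (a b : ℚ) (k : Fin (N - 1)) :
    solution N a b 0 k = a - (a - b) / N * (k.val + 1) := by
  have hk := k.isLt
  have hN : (N : ℚ) ≠ 0 := by
    have : N ≠ 0 := by omega
    exact_mod_cast this
  set f : Fin (N - 1) → ℚ := fun k => a - (a - b) / N * (k.val + 1) with hf
  suffices h : f = solution N a b 0 by rw [← h]
  have hp : ∀ j, j ≤ N → path a b f j = a - (a - b) / N * j := by
    intro j hj
    rcases j with _ | j
    · simp
    · by_cases h : j < N - 1
      · rw [path_succ _ _ _ h, hf]
        push_cast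
        ring
      · rw [path_of_lt _ _ _ (by omega), show j + 1 = N by omega]
        field_simp
        ring
  rw [eq_solution_iff]
  intro k
  have hk := k.isLt
  rw [hp _ (by omega), hp _ (by omega)]
  simp only [hf, Pi.zero_apply]
  push_cast
  ring

/-- For `n = 0` the solution is the linear interpolation between `a` and `b`. Hence `2 C⁻¹ n` is the
gap between this chord and the solution. -/
theorem inv_cartan_mulVec {N : ℕ} (a b : ℚ) (n : Fin (N - 1) → ℤ) (k : Fin (N - 1)) :
    ((cartan N)⁻¹ *ᵥ toRat n) k
      = (a - (a - b) / N * (k.val + 1) - solution N a b n k) / 2 := by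
  rw [← solution_zero]
  simp only [solution, Matrix.mulVec_sub, Matrix.mulVec_smul, Pi.sub_apply, Pi.smul_apply,
    smul_eq_mul]
  have : toRat (0 : Fin (N - 1) → ℤ) = 0 := by funext k; simp [toRat]
  rw [this, Matrix.mulVec_zero, Pi.zero_apply]
  ring

/-- Summation by parts. -/
theorem sum_mul_second_difference (u : ℕ → ℚ) (d : ℕ) :
    ∑ k ∈ Finset.range d, u (k + 1) * (u k - 2 * u (k + 1) + u (k + 2))
      = u (d + 1) * (u (d + 1) - u d) - u 0 * (u 1 - u 0)
        - ∑ k ∈ Finset.range (d + 1), (u (k + 1) - u k) ^ 2 := by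
  induction d with
  | zero => simp; ring
  | succ d ih =>
    rw [Finset.sum_range_succ, ih, Finset.sum_range_succ _ (d + 1)]
    ring

theorem sum_sq_difference_sub (x : ℕ → ℚ) (c : ℚ) (n : ℕ) :
    ∑ k ∈ Finset.range n, (x k - x (k + 1) - c) ^ 2
      = ∑ k ∈ Finset.range n, (x k - x (k + 1)) ^ 2 - 2 * c * (x 0 - x n) + n * c ^ 2 := by
  induction n with
  | zero => simp
  | succ n ih =>
    rw [Finset.sum_range_succ, ih, Finset.sum_range_succ]
    push_cast
    ring

theorem quadratic_form_eq {N : ℕ} (hN : 1 ≤ N) (a b : ℚ) (n : Fin (N - 1) → ℤ) :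
    toRat n ⬝ᵥ ((cartan N)⁻¹ *ᵥ toRat n) =
      1 / 4 * ∑ j ∈ Finset.range (N - 1 + 1), (path a b (solution N a b n) j
        - path a b (solution N a b n) (j + 1)) ^ 2 - (a - b) ^ 2 / (4 * N) := by
  have hN0 : (N : ℚ) ≠ 0 := by
    have : N ≠ 0 := by omega
    exact_mod_cast this
  set x := path a b (solution N a b n) with hx
  set c := (a - b) / N with hc
  -- The gap between chord and solution: it vanishes at both ends, `C⁻¹ n` is `u / 2`, and `n` is
  -- minus half the second difference of `u`.
  set u : ℕ → ℚ := fun j => a - c * j - x j with hu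
  have hxN : x (N - 1 + 1) = b := path_of_lt _ _ _ (by omega)
  have hx0 : x 0 = a := rfl
  have hcast : (((N - 1 + 1 : ℕ)) : ℚ) = N := by rw [Nat.sub_add_cancel hN]
  have hu0 : u 0 = 0 := by simp [hu, hx0]
  have huN : u (N - 1 + 1) = 0 := by
    simp only [hu]
    rw [hxN, hcast, hc]
    field_simp
    ring
  have h1 : toRat n ⬝ᵥ ((cartan N)⁻¹ *ᵥ toRat n)
      = ∑ k ∈ Finset.range (N - 1), (-1 / 4) * (u (k + 1) * (u k - 2 * u (k + 1) + u (k + 2))) := by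
    rw [dotProduct, ← Fin.sum_univ_eq_sum_range
      (fun k => (-1 / 4) * (u (k + 1) * (u k - 2 * u (k + 1) + u (k + 2))))]
    refine Finset.sum_congr rfl fun k _ => ?_
    have h2 := solution_add N a b n k
    have h3 : solution N a b n k = x (k.val + 1) := (path_succ _ _ _ k.isLt).symm
    rw [inv_cartan_mulVec a b]
    rw [h3] at h2 ⊢
    rw [← hx] at h2
    have h4 : toRat n k = (x k.val + x (k.val + 2)) / 2 - x (k.val + 1) := by
      simp only [toRat]; linarith
    rw [h4]
    simp only [hu]
    push_cast
    ring
  rw [h1, ← Finset.mul_sum, sum_mul_second_difference, hu0, huN]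
  have h5 : ∑ k ∈ Finset.range (N - 1 + 1), (u (k + 1) - u k) ^ 2
      = ∑ k ∈ Finset.range (N - 1 + 1), (x k - x (k + 1) - c) ^ 2 := by
    refine Finset.sum_congr rfl fun k _ => ?_
    simp only [hu]
    push_cast
    ring
  rw [h5, sum_sq_difference_sub, hxN, hx0, hcast, hc]
  field_simp
  ring

/-- By `inv_cartan_mulVec` the fractions with denominator `N` cancel, and the condition becomes one
on the parity of the first interior entry. -/
theorem restricted_iff {N : ℕ} (hN : 1 ≤ N) (σ a b : ℤ) (n : Fin (N - 1) → ℤ) :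
    Restricted N σ (a - b) n ↔
      IsInt (((a : ℚ) + σ - path (a : ℚ) b (solution N a b n) 1) / 2) := by
  have hN0 : (N : ℚ) ≠ 0 := by
    have : N ≠ 0 := by omega
    exact_mod_cast this
  unfold Restricted
  have e : component 0 0 ((cartan N)⁻¹ *ᵥ toRat n) 1
      = (a - (a - b) / N - path (a : ℚ) b (solution N a b n) 1) / 2 := by
    rw [component_eq_path]
    by_cases h : 0 < N - 1
    · rw [path_succ _ _ _ h, path_succ _ _ _ h, inv_cartan_mulVec (a : ℚ) b]
      simp
    · rw [path_of_lt _ _ _ (by omega), path_of_lt _ _ _ (by omega)]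
      have : N = 1 := by omega
      subst this
      simp
  rw [e]
  have e2 : (((a - b : ℤ) : ℚ) + σ * N) / (2 * N) +
      (a - (a - b) / N - path (a : ℚ) b (solution N a b n) 1) / 2
      = ((a : ℚ) + σ - path (a : ℚ) b (solution N a b n) 1) / 2 := by
    push_cast
    field_simp
    ring
  rw [e2]

/-! ### From sums over `n` to sums over sequences -/

theorem finsum_comp_injective {α β : Type*} {g : β → α} (hg : Function.Injective g)
    {f : α → QSeries} (h : Function.support f ⊆ Set.range g) : ∑ᶠ b, f (g b) = ∑ᶠ a, f a := by
  rw [← finsum_mem_range hg, ← finsum_mem_univ f]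
  exact finsum_mem_inter_support_eq _ _ _ (by
    rw [Set.univ_inter, Set.inter_eq_right.mpr h])

/-- The weight of a sequence with rational entries. -/
noncomputable def ratChainWeight {d : ℕ} (a b : ℚ) (m : Fin d → ℚ) : QSeries :=
  qPow (1 / 4 * ∑ j ∈ Finset.range (d + 1), (path a b m j - path a b m (j + 1)) ^ 2) *
    ∏ j ∈ Finset.range d, qBinom ((path a b m j + path a b m (j + 2)) / 2) (path a b m (j + 1))

/-- The symmetry `[m + n ; n] = [m + n ; m]` removes `n` from the binomials. -/
theorem weight_eq {N : ℕ} (hN : 1 ≤ N) (a b : ℚ) (n : Fin (N - 1) → ℤ) :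
    weight N a b n = qPow (-((a - b) ^ 2 / (4 * N))) * ratChainWeight a b (solution N a b n) := by
  unfold weight ratChainWeight
  rw [quadratic_form_eq hN a b n, sub_eq_add_neg, qPow_add, ← Fin.prod_univ_eq_prod_range
    (fun j => qBinom ((path a b (solution N a b n) j + path a b (solution N a b n) (j + 2)) / 2)
      (path a b (solution N a b n) (j + 1)))]
  have : ∀ k : Fin (N - 1), qBinom (solution N a b n k + n k) (n k)
      = qBinom ((path a b (solution N a b n) k.val + path a b (solution N a b n) (k.val + 2)) / 2)
      (path a b (solution N a b n) (k.val + 1)) := by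
    intro k
    rw [← solution_add, path_succ _ _ _ k.isLt, ← qBinom_symm _ (n k : ℚ), add_sub_cancel_right]
  simp only [this]
  ring

theorem path_cast {d : ℕ} (a b : ℤ) (v : Fin d → ℤ) (j : ℕ) :
    path (a : ℚ) b (fun k => (v k : ℚ)) j = ((path a b v j : ℤ) : ℚ) :=
  (map_path a b v (fun z : ℤ => (z : ℚ)) j).symm

/-- If all entries are non-negative, so are the upper entries and the binomials coincide; a negative
interior entry is a negative lower entry and kills both products. -/
theorem ratChainWeight_cast {d : ℕ} {a b : ℤ} (ha : 0 ≤ a) (hb : 0 ≤ b) (v : Fin d → ℤ) :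
    ratChainWeight (a : ℚ) b (fun k => (v k : ℚ)) = chainWeight a b v := by
  unfold ratChainWeight chainWeight
  simp only [path_cast]
  congr 1
  by_cases h : ∀ j, 0 ≤ path a b v j
  · refine Finset.prod_congr rfl fun j _ => ?_
    have h1 : (0 : ℚ) ≤ (path a b v j : ℤ) := by exact_mod_cast h j
    have h2 : (0 : ℚ) ≤ (path a b v (j + 2) : ℤ) := by exact_mod_cast h (j + 2)
    rw [qBinom_eq_ratBinom _ (by positivity)]
  · push Not at h
    obtain ⟨j, hj⟩ := h
    rcases j with _ | j
    · exact absurd hj (not_lt.mpr ha)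
    · by_cases hjd : j < d
      · rw [Finset.prod_eq_zero (Finset.mem_range.mpr hjd), Finset.prod_eq_zero
          (Finset.mem_range.mpr hjd)]
        · by_contra h'
          have := nonneg_of_ratBinom_ne_zero h'
          omega
        · exact qBinom_of_neg_right (by exact_mod_cast hj)
      · rw [path_of_lt _ _ _ (by omega)] at hj
        omega

theorem support_ratChainWeight_int {d : ℕ} {a b : ℚ} {m : Fin d → ℚ}
    (h : ratChainWeight a b m ≠ 0) (k : Fin d) :
    ∃ z w : ℤ, m k = w ∧ (path a b m k.val + path a b m (k.val + 2)) / 2 = z := by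
  obtain ⟨z, w, h1, h2, _⟩ := exists_int_of_qBinom_ne_zero
    (Finset.prod_ne_zero_iff.mp (right_ne_zero_of_mul h) k.val (Finset.mem_range.mpr k.isLt))
  rw [path_succ _ _ _ k.isLt] at h2
  exact ⟨z, w, h2, h1⟩

theorem finsum_weight_mul {N : ℕ} (hN : 1 ≤ N) {a b : ℤ} (ha : 0 ≤ a) (hb : 0 ≤ b)
    (F : (Fin (N - 1) → ℚ) → QSeries) :
    ∑ᶠ n : Fin (N - 1) → ℤ, weight N a b n * F (solution N a b n) =
      qPow (-(((a : ℚ) - b) ^ 2 / (4 * N))) *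
        ∑ᶠ v : Fin (N - 1) → ℤ, chainWeight a b v * F (fun k => (v k : ℚ)) := by
  simp only [weight_eq hN, ← ratChainWeight_cast ha hb, mul_assoc]
  rw [← mul_finsum]
  congr 1
  rw [finsum_comp_injective (g := solution N (a : ℚ) b) (solution_injective N a b)
    (f := fun m => ratChainWeight (a : ℚ) b m * F m),
    finsum_comp_injective (g := fun (v : Fin (N - 1) → ℤ) k => (v k : ℚ))
    (f := fun m => ratChainWeight (a : ℚ) b m * F m)]
  · intro v v' h
    funext k
    have : (v k : ℚ) = v' k := congrFun h k
    exact_mod_cast this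
  · intro m hm
    choose z w hw _ using support_ratChainWeight_int (left_ne_zero_of_mul hm)
    exact ⟨w, funext fun k => (hw k).symm⟩
  · intro m hm
    choose z w hw hz using support_ratChainWeight_int (left_ne_zero_of_mul hm)
    -- Conversely, a sequence of non-zero weight comes from an integral `n`, since both `m` and `m +
    -- n` are integral.
    refine ⟨fun k => z k - w k, ((eq_solution_iff _ _ _ _).mpr fun k => ?_).symm⟩
    rw [hz, hw]
    push_cast
    ring

theorem finite_support_weight {N : ℕ} (hN : 1 ≤ N) {a b : ℤ} (ha : 0 ≤ a) (hb : 0 ≤ b) :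
    {n : Fin (N - 1) → ℤ | weight N a b n ≠ 0}.Finite := by
  refine Set.Finite.of_finite_image (f := solution N (a : ℚ) b) ?_
    (solution_injective N a b).injOn
  refine ((finite_pi_Icc (N - 1) (max a b)).image fun v k => (v k : ℚ)).subset ?_
  rintro _ ⟨n, hn, rfl⟩
  rw [Set.mem_ofPred_eq, weight_eq hN] at hn
  have hn' := right_ne_zero_of_mul hn
  choose z w hw _ using support_ratChainWeight_int hn'
  have e : solution N (a : ℚ) b n = fun k => (w k : ℚ) := funext hw
  rw [e, ratChainWeight_cast ha hb] at hn'
  exact ⟨w, chainWeight_mem_pi ha hb hn' le_rfl, e.symm⟩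


/-! ### The generalized `q`-Saalschütz sum for standard `q`-binomials -/

/-- The condition under which the generalized `q`-Saalschütz sum holds for the standard
`q`-binomials, with `ℓ = M₁ - M₂`. -/
def Admissible (d : ℕ) (ℓ : ℤ) (L₁ L₂ : ℚ) : Prop :=
  0 ≤ L₁ + ℓ * d / (2 * (d + 1)) → 0 ≤ L₂ - ℓ * d / (2 * (d + 1)) →
    (0 ≤ L₁ + ℓ ∨ L₂ ≤ L₁ + ℓ) ∧ (0 ≤ L₂ - ℓ ∨ L₁ ≤ L₂ - ℓ)

/-- Only the two outer binomials have to be the standard ones. The inner binomials agree in both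
readings on sequences with non-negative ends. -/
noncomputable def etaTerm {d : ℕ} (M₁ : ℤ) (L₁ : ℚ) (M₂ : ℤ) (L₂ : ℚ) (v : Fin d → ℤ) :
    QSeries :=
  chainWeight M₁ M₂ v * qBinom (M₁ + L₁ - (M₂ - (path M₁ M₂ v 1 : ℤ)) / 2) M₁ *
    qBinom (M₂ + L₂ - (M₁ - (path M₁ M₂ v d : ℤ)) / 2) M₂

noncomputable def chainTransformTerm {d : ℕ} (M₁ : ℤ) (L₁ : ℚ) (M₂ : ℤ) (L₂ : ℚ) (i : ℤ)
    (v : Fin d → ℤ) : QSeries :=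
  chainWeight (2 * i + (M₁ - M₂)) 0 v * qBinom (L₁ + L₂ + M₂ - i) (M₂ - i : ℤ) *
    qBinom (L₁ + (M₁ - M₂) + (path (2 * i + (M₁ - M₂)) 0 v 1 : ℤ) / 2) (i + (M₁ - M₂) : ℤ) *
    qBinom (L₂ - (M₁ - M₂) + (path (2 * i + (M₁ - M₂)) 0 v 1 : ℤ) / 2) i

/-- If the upper entry of one of two binomials is negative, then the other one vanishes. -/
theorem qBinom_mul_qBinom_eq {t u : ℚ} {a b : ℤ} (h₁ : t < 0 → 0 ≤ u ∧ u < b)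
    (h₂ : u < 0 → 0 ≤ t ∧ t < a) : qBinom t a * qBinom u b = ratBinom t a * ratBinom u b := by
  rcases lt_or_ge t 0 with ht | ht
  · obtain ⟨hu, hub⟩ := h₁ ht
    have : ratBinom u b = 0 := by
      by_contra h
      exact absurd (le_of_ratBinom_ne_zero h hu) (not_le.mpr hub)
    rw [qBinom_of_neg ht, this]
    ring
  · rcases lt_or_ge u 0 with hu | hu
    · obtain ⟨_, hta⟩ := h₂ hu
      have : ratBinom t a = 0 := by
        by_contra h
        exact absurd (le_of_ratBinom_ne_zero h ht) (not_le.mpr hta)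
      rw [qBinom_of_neg hu, this]
      ring
    · rw [qBinom_eq_ratBinom _ ht, qBinom_eq_ratBinom _ hu]

theorem interpolation_le {D a b x : ℚ} (hD : 0 ≤ D) (h : (D + 1) * x ≤ D * a + b) :
    x ≤ a - (a - b) / (D + 1) := by
  have hD' : 0 < D + 1 := by linarith
  have : a - (a - b) / (D + 1) = (D * a + b) / (D + 1) := by field_simp; ring
  rw [this, le_div_iff₀ hD']
  linarith

theorem path_one_le_interpolation {d : ℕ} {a b : ℤ} {v : Fin d → ℤ} (ha : 0 ≤ a) (hb : 0 ≤ b)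
    (h : chainWeight a b v ≠ 0) :
    ((path a b v 1 : ℤ) : ℚ) ≤ a - (a - b) / (d + 1) := by
  refine interpolation_le (by positivity) ?_
  have := path_le_interpolation ha hb h (j := 1) (by omega)
  push_cast at this
  linarith

theorem path_last_le_interpolation {d : ℕ} {a b : ℤ} {v : Fin d → ℤ} (ha : 0 ≤ a) (hb : 0 ≤ b)
    (h : chainWeight a b v ≠ 0) :
    ((path a b v d : ℤ) : ℚ) ≤ b - (b - a) / (d + 1) := by
  refine interpolation_le (by positivity) ?_
  have := path_le_interpolation ha hb h (j := d) (by omega)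
  linarith

theorem half_mul_div_succ (d : ℕ) (ℓ : ℚ) :
    ℓ * d / (2 * (d + 1)) = (ℓ - ℓ / (d + 1)) / 2 := by
  have : (d : ℚ) + 1 ≠ 0 := by positivity
  field_simp
  ring

/-- If the first upper entry is negative, then `L₁ + (a - b) < 0`, so the second alternative of `h₁`
holds and bounds `L₂` from above. With the chord bound on `y` this pushes the second upper entry
below its lower entry, while `h₂` keeps it non-negative. -/
theorem etaTerm_eq_polyEtaTerm_aux {D a b x y L₁ L₂ : ℚ} (hD : 0 ≤ D) (ha : 0 ≤ a) (hb : 0 ≤ b)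
    (hx : 0 ≤ x) (hy : 0 ≤ y) (hya : y ≤ b - (b - a) / (D + 1)) (hL : 0 ≤ L₁ + L₂)
    (h₁ : 0 ≤ L₁ + (a - b) ∨ L₂ ≤ L₁ + (a - b)) (h₂ : 0 ≤ L₂ - (a - b) ∨ L₁ ≤ L₂ - (a - b))
    (ht : a + L₁ - (b - x) / 2 < 0) :
    0 ≤ b + L₂ - (a - y) / 2 ∧ b + L₂ - (a - y) / 2 < b := by
  have e1 : L₁ + (a - b) < 0 := by linarith
  have e2 : L₂ ≤ L₁ + (a - b) := h₁.resolve_left (not_le.mpr e1)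
  have e3 : 0 ≤ L₂ - (a - b) := by
    rcases h₂ with h | h
    · exact h
    · linarith
  have e4 : 0 ≤ a / (D + 1) := by positivity
  have e5 : 0 ≤ b - b / (D + 1) := by
    rw [sub_nonneg]
    exact div_le_self hb (by linarith)
  have e6 := hya.trans_eq (congrArg (b - ·) (sub_div b a (D + 1)))
  have e7 := add_nonneg ha hy
  constructor <;> linarith

theorem etaTerm_eq_polyEtaTerm {d : ℕ} {M₁ M₂ : ℤ} {L₁ L₂ : ℚ} (hM₁ : 0 ≤ M₁) (hM₂ : 0 ≤ M₂)
    (hL : 0 ≤ L₁ + L₂) (h₁ : 0 ≤ L₁ + (M₁ - M₂ : ℤ) ∨ L₂ ≤ L₁ + (M₁ - M₂ : ℤ))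
    (h₂ : 0 ≤ L₂ - (M₁ - M₂ : ℤ) ∨ L₁ ≤ L₂ - (M₁ - M₂ : ℤ)) (v : Fin d → ℤ) :
    etaTerm M₁ L₁ M₂ L₂ v = polyEtaTerm M₁ L₁ M₂ L₂ v := by
  unfold etaTerm polyEtaTerm
  by_cases h : chainWeight M₁ M₂ v = 0
  · simp [h]
  · have a1 : (0 : ℚ) ≤ M₁ := by exact_mod_cast hM₁
    have a2 : (0 : ℚ) ≤ M₂ := by exact_mod_cast hM₂
    have a3 : (0 : ℚ) ≤ (path M₁ M₂ v 1 : ℤ) := by exact_mod_cast path_nonneg hM₁ hM₂ h 1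
    have a4 : (0 : ℚ) ≤ (path M₁ M₂ v d : ℤ) := by exact_mod_cast path_nonneg hM₁ hM₂ h d
    have a5 := path_one_le_interpolation hM₁ hM₂ h
    have a6 := path_last_le_interpolation hM₁ hM₂ h
    push_cast at h₁ h₂
    rw [mul_assoc, mul_assoc, qBinom_mul_qBinom_eq]
    · exact etaTerm_eq_polyEtaTerm_aux (D := d) (by positivity) a1 a2 a3 a4 a6 hL h₁ h₂
    · refine etaTerm_eq_polyEtaTerm_aux (D := d) (by positivity) a2 a1 a4 a3 a5 (by linarith) ?_ ?_
      · exact h₂.imp (fun h => by linarith) (fun h => by linarith)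
      · exact h₁.imp (fun h => by linarith) (fun h => by linarith)

theorem chainTransformTerm_eq_zero {d : ℕ} {M₁ M₂ : ℤ} {L₁ L₂ : ℚ} {i : ℤ} (v : Fin d → ℤ)
    (h : i < 0 ∨ i + (M₁ - M₂) < 0 ∨ M₂ < i) : chainTransformTerm M₁ L₁ M₂ L₂ i v = 0 := by
  unfold chainTransformTerm
  rcases h with h | h | h
  · rw [qBinom_of_neg_right (b := (i : ℚ)) (by exact_mod_cast h)]; ring
  · rw [qBinom_of_neg_right (b := ((i + (M₁ - M₂) : ℤ) : ℚ)) (by exact_mod_cast h)]; ring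
  · rw [qBinom_of_neg_right (b := ((M₂ - i : ℤ) : ℚ)) (by
      have : M₂ - i < 0 := by omega
      exact_mod_cast this)]; ring

theorem chainTransformTerm_eq_polyTransformTerm {d : ℕ} {M₁ M₂ : ℤ} {L₁ L₂ : ℚ}
    (hL : 0 ≤ L₁ + L₂) (h₁ : 0 ≤ L₁ + (M₁ - M₂ : ℤ) ∨ L₂ ≤ L₁ + (M₁ - M₂ : ℤ))
    (h₂ : 0 ≤ L₂ - (M₁ - M₂ : ℤ) ∨ L₁ ≤ L₂ - (M₁ - M₂ : ℤ)) (i : ℤ) (v : Fin d → ℤ) :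
    chainTransformTerm M₁ L₁ M₂ L₂ i v = polyTransformTerm M₁ L₁ M₂ L₂ i v := by
  by_cases hi : i < 0 ∨ i + (M₁ - M₂) < 0 ∨ M₂ < i
  · rw [chainTransformTerm_eq_zero v hi]
    by_contra h
    have := polyTransformTerm_bounds (Ne.symm h)
    omega
  · unfold chainTransformTerm polyTransformTerm
    by_cases h : chainWeight (2 * i + (M₁ - M₂)) 0 v = 0
    · simp [h]
    · have a0 : 0 ≤ 2 * i + (M₁ - M₂) := by omega
      have a3 : (0 : ℚ) ≤ (path (2 * i + (M₁ - M₂)) 0 v 1 : ℤ) := by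
        exact_mod_cast path_nonneg a0 le_rfl h 1
      have a1 : (0 : ℚ) ≤ i := by
        have : 0 ≤ i := by omega
        exact_mod_cast this
      have a2 : (0 : ℚ) ≤ i + (M₁ - M₂) := by
        have : 0 ≤ i + (M₁ - M₂) := by omega
        exact_mod_cast this
      have a4 : (i : ℚ) ≤ M₂ := by
        have : i ≤ M₂ := by omega
        exact_mod_cast this
      push_cast at h₁ h₂
      rw [qBinom_eq_ratBinom _ (show 0 ≤ L₁ + L₂ + M₂ - i by linarith), mul_assoc, mul_assoc,
        mul_assoc, mul_assoc, qBinom_mul_qBinom_eq]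
      · intro ht
        have e1 : L₁ + ((M₁ : ℚ) - M₂) < 0 := by linarith
        have e2 := h₁.resolve_left (not_le.mpr e1)
        have e3 : 0 ≤ L₂ - ((M₁ : ℚ) - M₂) := by
          rcases h₂ with h | h
          · exact h
          · linarith
        constructor <;> linarith
      · intro ht
        have e1 : L₂ - ((M₁ : ℚ) - M₂) < 0 := by linarith
        have e2 := h₂.resolve_left (not_le.mpr e1)
        have e3 : 0 ≤ L₁ + ((M₁ : ℚ) - M₂) := by
          rcases h₁ with h | h
          · exact h
          · linarith
        push_cast
        constructor <;> linarith

/-- A non-zero standard binomial has lower entry at most its upper entry; inserting the chord bounds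
for the entries next to the ends gives both premises of `Admissible`. -/
theorem etaTerm_eq_zero {d : ℕ} {M₁ M₂ : ℤ} {L₁ L₂ : ℚ} (hM₁ : 0 ≤ M₁) (hM₂ : 0 ≤ M₂)
    (h : L₁ + (M₁ - M₂ : ℤ) * d / (2 * (d + 1)) < 0 ∨
      L₂ - (M₁ - M₂ : ℤ) * d / (2 * (d + 1)) < 0) (v : Fin d → ℤ) :
    etaTerm M₁ L₁ M₂ L₂ v = 0 := by
  by_contra h'
  have b1 := (bounds_of_qBinom_ne_zero (right_ne_zero_of_mul h')).2
  have b2 := (bounds_of_qBinom_ne_zero (right_ne_zero_of_mul (left_ne_zero_of_mul h'))).2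
  have h0 := left_ne_zero_of_mul (left_ne_zero_of_mul h')
  have a5 := path_one_le_interpolation hM₁ hM₂ h0
  have a6 := path_last_le_interpolation hM₁ hM₂ h0
  rw [half_mul_div_succ] at h
  push_cast at h
  rw [sub_div (M₁ : ℚ) M₂ (d + 1)] at h a5
  rw [sub_div (M₂ : ℚ) M₁ (d + 1)] at a6
  rcases h with h | h <;> linarith

theorem chainTransformTerm_eq_zero' {d : ℕ} {M₁ M₂ : ℤ} {L₁ L₂ : ℚ}
    (h : L₁ + (M₁ - M₂ : ℤ) * d / (2 * (d + 1)) < 0 ∨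
      L₂ - (M₁ - M₂ : ℤ) * d / (2 * (d + 1)) < 0) (i : ℤ) (v : Fin d → ℤ) :
    chainTransformTerm M₁ L₁ M₂ L₂ i v = 0 := by
  by_contra h'
  have b1 := bounds_of_qBinom_ne_zero (right_ne_zero_of_mul h')
  have b2 := bounds_of_qBinom_ne_zero (right_ne_zero_of_mul (left_ne_zero_of_mul h'))
  have h0 := left_ne_zero_of_mul (left_ne_zero_of_mul (left_ne_zero_of_mul h'))
  have a0 : 0 ≤ 2 * i + (M₁ - M₂) := by
    have : (0 : ℚ) ≤ i + (i + (M₁ - M₂) : ℤ) := by linarith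
    have : 0 ≤ i + (i + (M₁ - M₂)) := by exact_mod_cast this
    omega
  have a5 := path_one_le_interpolation a0 le_rfl h0
  rw [half_mul_div_succ] at h
  have c1 : 0 ≤ (i : ℚ) / (d + 1) := div_nonneg b1.1 (by positivity)
  have c2 : 0 ≤ ((i + (M₁ - M₂) : ℤ) : ℚ) / (d + 1) := div_nonneg b2.1 (by positivity)
  push_cast at h a5 b2 c2
  have e : (2 * (i : ℚ) + (M₁ - M₂) - 0) / (d + 1)
      = i / (d + 1) + (i + (M₁ - M₂)) / (d + 1) := by ring
  have e' : ((i : ℚ) + (M₁ - M₂)) / (d + 1) = i / (d + 1) + (M₁ - M₂) / (d + 1) := by ring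
  rw [e] at a5
  rcases h with h | h <;> linarith [b1.2, b2.2]

theorem finsum_etaTerm_eq {d : ℕ} {M₁ M₂ : ℤ} {L₁ L₂ : ℚ} (hM₁ : 0 ≤ M₁) (hM₂ : 0 ≤ M₂)
    (h : Admissible d (M₁ - M₂) L₁ L₂) :
    ∑ᶠ v : Fin d → ℤ, etaTerm M₁ L₁ M₂ L₂ v
      = ∑ᶠ i : ℤ, ∑ᶠ v : Fin d → ℤ, chainTransformTerm M₁ L₁ M₂ L₂ i v := by
  by_cases hz : L₁ + (M₁ - M₂ : ℤ) * d / (2 * (d + 1)) < 0 ∨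
      L₂ - (M₁ - M₂ : ℤ) * d / (2 * (d + 1)) < 0
  · rw [finsum_eq_zero_of_forall_eq_zero (etaTerm_eq_zero hM₁ hM₂ hz),
      finsum_eq_zero_of_forall_eq_zero fun i =>
        finsum_eq_zero_of_forall_eq_zero (chainTransformTerm_eq_zero' hz i)]
  · push Not at hz
    obtain ⟨h₁, h₂⟩ := h hz.1 hz.2
    have hL : 0 ≤ L₁ + L₂ := by linarith [hz.1, hz.2]
    simp only [etaTerm_eq_polyEtaTerm hM₁ hM₂ hL h₁ h₂,
      chainTransformTerm_eq_polyTransformTerm hL h₁ h₂]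
    exact polyEta_eq_polyTransform d M₁ L₁ M₂ L₂

/-! ### The generalized `q`-Saalschütz sum in terms of `(m,n)`-systems -/

/-- The summand over `η` of a level-`N` polynomial, without the restriction on `η`. -/
noncomputable def levelTerm (N : ℕ) (M₁ : ℤ) (L₁ : ℚ) (M₂ : ℤ) (L₂ : ℚ)
    (η : Fin (N - 1) → ℤ) : QSeries :=
  weight N M₁ M₂ η *
    (qBinom (M₁ + L₁ - (M₂ - path (M₁ : ℚ) M₂ (solution N M₁ M₂ η) 1) / 2) M₁ *
    qBinom (M₂ + L₂ - (M₁ - path (M₁ : ℚ) M₂ (solution N M₁ M₂ η) (N - 1)) / 2) M₂)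

/-- The summand over `n` of the transform of a single product of two binomials, without the
restriction on `n`. -/
noncomputable def pairTerm (N : ℕ) (ℓ : ℤ) (L₁ L₂ : ℚ) (i : ℤ)
    (n : Fin (N - 1) → ℤ) : QSeries :=
  weight N (2 * i + ℓ : ℤ) (0 : ℤ) n *
    (qBinom (L₁ + ℓ + path ((2 * i + ℓ : ℤ) : ℚ) (0 : ℤ) (solution N (2 * i + ℓ : ℤ) (0 : ℤ) n) 1 / 2)
      (i + ℓ : ℤ) *
    qBinom (L₂ - ℓ + path ((2 * i + ℓ : ℤ) : ℚ) (0 : ℤ) (solution N (2 * i + ℓ : ℤ) (0 : ℤ) n) 1 / 2)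
      i)

theorem levelTerm_bounds {N : ℕ} {M₁ M₂ : ℤ} {L₁ L₂ : ℚ} {η : Fin (N - 1) → ℤ}
    (h : levelTerm N M₁ L₁ M₂ L₂ η ≠ 0) : 0 ≤ M₁ ∧ 0 ≤ M₂ := by
  have h1 := (bounds_of_qBinom_ne_zero (right_ne_zero_of_mul (right_ne_zero_of_mul h))).1
  have h2 := (bounds_of_qBinom_ne_zero
    (left_ne_zero_of_mul (right_ne_zero_of_mul h))).1
  exact ⟨by exact_mod_cast h2, by exact_mod_cast h1⟩

theorem pairTerm_bounds {N : ℕ} {ℓ i : ℤ} {L₁ L₂ : ℚ} {n : Fin (N - 1) → ℤ}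
    (h : pairTerm N ℓ L₁ L₂ i n ≠ 0) : 0 ≤ i ∧ 0 ≤ i + ℓ := by
  have h1 := (bounds_of_qBinom_ne_zero (right_ne_zero_of_mul (right_ne_zero_of_mul h))).1
  have h2 := (bounds_of_qBinom_ne_zero
    (left_ne_zero_of_mul (right_ne_zero_of_mul h))).1
  exact ⟨by exact_mod_cast h1, by exact_mod_cast h2⟩

theorem finite_support_levelTerm {N : ℕ} (hN : 1 ≤ N) (M₁ : ℤ) (L₁ : ℚ) (M₂ : ℤ) (L₂ : ℚ) :
    (Function.support (levelTerm N M₁ L₁ M₂ L₂)).Finite := by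
  by_cases h : 0 ≤ M₁ ∧ 0 ≤ M₂
  · exact (finite_support_weight hN h.1 h.2).subset fun η hη => left_ne_zero_of_mul hη
  · refine Set.finite_empty.subset fun η hη => h (levelTerm_bounds hη)

theorem finsum_levelTerm {N : ℕ} (hN : 1 ≤ N) {M₁ : ℤ} (L₁ : ℚ) {M₂ : ℤ} (L₂ : ℚ)
    (hM₁ : 0 ≤ M₁) (hM₂ : 0 ≤ M₂) :
    ∑ᶠ η, levelTerm N M₁ L₁ M₂ L₂ η = qPow (-(((M₁ : ℚ) - M₂) ^ 2 / (4 * N))) *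
      ∑ᶠ v : Fin (N - 1) → ℤ, etaTerm M₁ L₁ M₂ L₂ v := by
  have := finsum_weight_mul hN hM₁ hM₂ fun m : Fin (N - 1) → ℚ =>
    qBinom (M₁ + L₁ - (M₂ - path (M₁ : ℚ) M₂ m 1) / 2) M₁ *
      qBinom (M₂ + L₂ - (M₁ - path (M₁ : ℚ) M₂ m (N - 1)) / 2) M₂
  unfold levelTerm
  rw [this]
  congr 1
  refine finsum_congr fun v => ?_
  rw [path_cast, path_cast, etaTerm, mul_assoc]

/-- Completing the square: `i (i + ℓ) / N - (2 i + ℓ)² / (4 N) = -ℓ² / (4 N)` with `ℓ = M₁ - M₂`, so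
the prefactor does not depend on `i` and matches that of `finsum_levelTerm`. -/
theorem finsum_pairTerm {N : ℕ} (hN : 1 ≤ N) (M₁ : ℤ) (L₁ : ℚ) (M₂ : ℤ) (L₂ : ℚ) (i : ℤ) :
    qPow ((i : ℚ) * (i + (M₁ - M₂)) / N) * (qBinom (L₁ + L₂ + M₂ - i) (M₂ - i : ℤ) *
      ∑ᶠ n, pairTerm N (M₁ - M₂) L₁ L₂ i n) = qPow (-(((M₁ : ℚ) - M₂) ^ 2 / (4 * N))) *
      ∑ᶠ v : Fin (N - 1) → ℤ, chainTransformTerm M₁ L₁ M₂ L₂ i v := by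
  have hN0 : (N : ℚ) ≠ 0 := by
    have : N ≠ 0 := by omega
    exact_mod_cast this
  by_cases h : 0 ≤ i ∧ 0 ≤ i + (M₁ - M₂)
  · have := finsum_weight_mul hN (show 0 ≤ 2 * i + (M₁ - M₂) by omega) le_rfl
      fun m : Fin (N - 1) → ℚ =>
      qBinom (L₁ + (M₁ - M₂ : ℤ) + path ((2 * i + (M₁ - M₂) : ℤ) : ℚ) (0 : ℤ) m 1 / 2)
        (i + (M₁ - M₂) : ℤ) *
      qBinom (L₂ - (M₁ - M₂ : ℤ) + path ((2 * i + (M₁ - M₂) : ℤ) : ℚ) (0 : ℤ) m 1 / 2) i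
    unfold pairTerm
    rw [this, mul_left_comm _ (qPow _), ← mul_assoc, ← qPow_add]
    refine (qPow_mul_eq (b := -(((M₁ : ℚ) - M₂) ^ 2 / (4 * N))) ?_ _).trans ?_
    · push_cast
      field_simp
      ring
    · congr 1
      rw [mul_finsum]
      refine finsum_congr fun v => ?_
      rw [path_cast, chainTransformTerm]
      push_cast
      ring
  · have h1 : ∀ n, pairTerm N (M₁ - M₂) L₁ L₂ i n = 0 := by
      intro n
      by_contra h'
      exact h (pairTerm_bounds h')
    have h2 : ∀ v : Fin (N - 1) → ℤ, chainTransformTerm M₁ L₁ M₂ L₂ i v = 0 :=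
      fun v => chainTransformTerm_eq_zero v (by omega)
    rw [finsum_eq_zero_of_forall_eq_zero h1, finsum_eq_zero_of_forall_eq_zero h2]
    ring

/-- The generalized `q`-Saalschütz sum. -/
theorem finsum_levelTerm_eq {N : ℕ} (hN : 1 ≤ N) {M₁ M₂ : ℤ} {L₁ L₂ : ℚ}
    (h : Admissible (N - 1) (M₁ - M₂) L₁ L₂) :
    ∑ᶠ η, levelTerm N M₁ L₁ M₂ L₂ η = ∑ᶠ i : ℤ, qPow ((i : ℚ) * (i + (M₁ - M₂)) / N) *
      (qBinom (L₁ + L₂ + M₂ - i) (M₂ - i : ℤ) * ∑ᶠ n, pairTerm N (M₁ - M₂) L₁ L₂ i n) := by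
  simp only [finsum_pairTerm hN]
  rw [← mul_finsum]
  by_cases hM : 0 ≤ M₁ ∧ 0 ≤ M₂
  · rw [finsum_levelTerm hN L₁ L₂ hM.1 hM.2, finsum_etaTerm_eq hM.1 hM.2 h]
  · rw [finsum_eq_zero_of_forall_eq_zero, finsum_eq_zero_of_forall_eq_zero, mul_zero]
    · exact fun i => finsum_eq_zero_of_forall_eq_zero fun v =>
        chainTransformTerm_eq_zero v (by omega)
    · intro η
      by_contra h'
      exact hM (levelTerm_bounds h')


/-! ### Level-`N` polynomials and the transform as sums of pair terms -/

theorem IsInt.of_eq {x y : ℚ} (h : IsInt x) (z : ℤ) (e : y = x + z) : IsInt y := by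
  obtain ⟨w, rfl⟩ := h
  exact ⟨w + z, by rw [e]; push_cast; ring⟩

/-- Integrality of the first upper entry, combined with that of `L₁ + (M₁ - M₂ + σ) / 2`, is exactly
the parity condition of `restricted_iff`. -/
theorem levelTerm_eq_zero_of_not_restricted {N : ℕ} (hN : 1 ≤ N) {σ M₁ M₂ : ℤ} {L₁ L₂ : ℚ}
    (hL : IsInt (L₁ + ((M₁ : ℚ) - M₂ + σ) / 2)) {η : Fin (N - 1) → ℤ}
    (h : ¬ Restricted N σ (M₁ - M₂) η) : levelTerm N M₁ L₁ M₂ L₂ η = 0 := by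
  by_contra h'
  obtain ⟨z, _, hz, _⟩ := exists_int_of_qBinom_ne_zero
    (left_ne_zero_of_mul (right_ne_zero_of_mul h'))
  refine h ((restricted_iff hN σ M₁ M₂ η).mpr (hL.of_eq (M₁ - z) ?_))
  push_cast
  linarith

theorem pairTerm_eq_zero_of_not_restricted {N : ℕ} (hN : 1 ≤ N) {σ ℓ i : ℤ} {L₁ L₂ : ℚ}
    (hL : IsInt (L₁ + ((ℓ : ℚ) + σ) / 2)) {n : Fin (N - 1) → ℤ}
    (h : ¬ Restricted N σ (2 * i + ℓ) n) : pairTerm N ℓ L₁ L₂ i n = 0 := by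
  by_contra h'
  obtain ⟨z, _, hz, _⟩ := exists_int_of_qBinom_ne_zero
    (left_ne_zero_of_mul (right_ne_zero_of_mul h'))
  rw [← sub_zero (2 * i + ℓ), restricted_iff hN σ (2 * i + ℓ) 0 n] at h
  refine h (hL.of_eq (i + ℓ - z) ?_)
  push_cast at hz ⊢
  linarith

theorem posInner_eq {N : ℕ} (hN : 1 ≤ N) {σ M₁ M₂ : ℤ} {L₁ : ℚ} (L₂ : ℚ)
    (hL : IsInt (L₁ + ((M₁ : ℚ) - M₂ + σ) / 2)) (p p' j : ℤ) (η : Fin (N - 1) → ℤ) :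
    posInner N σ p (p + N * p') M₁ L₁ M₂ L₂ j η = levelTerm N (M₁ + p * j)
      (L₁ - (p * j : ℤ) - (p' * j : ℤ)) (M₂ - p * j) (L₂ + (p * j : ℤ) + (p' * j : ℤ)) η := by
  have hN0 : (N : ℚ) ≠ 0 := by
    have : N ≠ 0 := by omega
    exact_mod_cast this
  have hL' : IsInt (L₁ - (p * j : ℤ) - (p' * j : ℤ) +
      (((M₁ + p * j : ℤ) : ℚ) - (M₂ - p * j : ℤ) + σ) / 2) :=
    hL.of_eq (-(p' * j)) (by push_cast; ring)
  have e : M₁ - M₂ + 2 * p * j = (M₁ + p * j) - (M₂ - p * j) := by ring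
  unfold posInner
  simp only []
  rw [e]
  split_ifs with h
  · simp only [levelTerm, component_eq_path]
    push_cast
    rw [mul_assoc]
    congr 2
    · congr 1
      field_simp
      ring
    · congr 1
      field_simp
      ring
  · rw [levelTerm_eq_zero_of_not_restricted hN hL' h]

theorem negInner_eq {N : ℕ} (hN : 1 ≤ N) {σ M₁ M₂ : ℤ} {L₁ : ℚ} (L₂ : ℚ)
    (hL : IsInt (L₁ + ((M₁ : ℚ) - M₂ + σ) / 2)) (p p' r s j : ℤ) (η : Fin (N - 1) → ℤ) :
    negInner N σ p (p + N * p') r (r + N * s) M₁ L₁ M₂ L₂ j η = levelTerm N (M₁ + (p * j + r))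
      (L₁ - (p * j + r : ℤ) - (p' * j + s : ℤ)) (M₂ - (p * j + r))
      (L₂ + (p * j + r : ℤ) + (p' * j + s : ℤ)) η := by
  have hN0 : (N : ℚ) ≠ 0 := by
    have : N ≠ 0 := by omega
    exact_mod_cast this
  have hL' : IsInt (L₁ - (p * j + r : ℤ) - (p' * j + s : ℤ) +
      (((M₁ + (p * j + r) : ℤ) : ℚ) - (M₂ - (p * j + r) : ℤ) + σ) / 2) :=
    hL.of_eq (-(p' * j + s)) (by push_cast; ring)
  have e : M₁ - M₂ + 2 * p * j + 2 * r = (M₁ + (p * j + r)) - (M₂ - (p * j + r)) := by ring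
  unfold negInner
  simp only []
  rw [e]
  split_ifs with h
  · simp only [levelTerm, component_eq_path]
    push_cast
    rw [mul_assoc]
    simp only [← add_assoc, ← sub_sub]
    congr 2
    · congr 1
      field_simp
      ring
    · congr 1
      field_simp
      ring
  · rw [levelTerm_eq_zero_of_not_restricted hN hL' h]

/-- The product of two binomials in Burge's polynomials. -/
noncomputable def burgePair (c t M₁ : ℤ) (L₁ : ℚ) (M₂ : ℤ) (L₂ : ℚ) : QSeries :=
  qBinom (M₁ + L₁ + c - t) (M₁ + c : ℤ) * qBinom (M₂ + L₂ - c + t) (M₂ - c : ℤ)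

/-- The exponent of `q` in the positive part of Burge's polynomials. -/
def posExp (p p' r s ℓ j : ℤ) : ℚ := j * (p * p' * j + p' * (ℓ + r) - p * s)

/-- The exponent of `q` in the negative part of Burge's polynomials. -/
def negExp (p p' r s ℓ j : ℤ) : ℚ := (p * j + ℓ + r) * (p' * j + s)

theorem burgeTerm_eq (p p' r s M₁ : ℤ) (L₁ : ℚ) (M₂ : ℤ) (L₂ : ℚ) (j : ℤ) :
    burgeTerm p p' r s M₁ L₁ M₂ L₂ j =
      qPow (posExp p p' r s (M₁ - M₂) j) * burgePair (p * j) (p' * j) M₁ L₁ M₂ L₂ -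
      qPow (negExp p p' r s (M₁ - M₂) j) *
        burgePair (p * j + r) (p' * j + s) M₁ L₁ M₂ L₂ := by
  unfold burgeTerm posExp negExp burgePair
  push_cast
  congr 1
  · rw [mul_assoc]
    congr 2
    · congr 1; ring
    · congr 1; ring
  · rw [mul_assoc]
    congr 2
    · congr 1 <;> ring
    · congr 1 <;> ring

theorem burgePair_bounds {c t M₁ M₂ : ℤ} {L₁ L₂ : ℚ} (h : burgePair c t M₁ L₁ M₂ L₂ ≠ 0) :
    -M₁ ≤ c ∧ c ≤ M₂ := by
  have h1 := (bounds_of_qBinom_ne_zero (right_ne_zero_of_mul h)).1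
  have h2 := (bounds_of_qBinom_ne_zero (left_ne_zero_of_mul h)).1
  have h1' : 0 ≤ M₂ - c := by exact_mod_cast h1
  have h2' : 0 ≤ M₁ + c := by exact_mod_cast h2
  omega

/-- Since `p ≥ 1`, only finitely many `j` give lower entries in the admissible range; this is the
source of finiteness for all sums over `j`. -/
theorem finite_affine {p : ℤ} (hp : 1 ≤ p) (r a b : ℤ) :
    {j : ℤ | a ≤ p * j + r ∧ p * j + r ≤ b}.Finite := by
  refine (Set.finite_Icc a b).preimage (f := fun j => p * j + r) fun x _ y _ h => ?_
  exact mul_left_cancel₀ (by omega) (add_right_cancel h)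

theorem burgeTerm_bounds {p p' r s M₁ M₂ : ℤ} {L₁ L₂ : ℚ} {j : ℤ}
    (h : burgeTerm p p' r s M₁ L₁ M₂ L₂ j ≠ 0) :
    (-M₁ ≤ p * j + 0 ∧ p * j + 0 ≤ M₂) ∨ (-M₁ ≤ p * j + r ∧ p * j + r ≤ M₂) := by
  rw [burgeTerm_eq] at h
  by_contra! h'
  apply h
  have h1 : burgePair (p * j) (p' * j) M₁ L₁ M₂ L₂ = 0 := by
    by_contra h2
    have := burgePair_bounds h2
    omega
  have h2 : burgePair (p * j + r) (p' * j + s) M₁ L₁ M₂ L₂ = 0 := by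
    by_contra h2
    have := burgePair_bounds h2
    omega
  rw [h1, h2]
  ring

theorem finite_support_burgeTerm {p : ℤ} (hp : 1 ≤ p) (p' r s M₁ : ℤ) (L₁ : ℚ) (M₂ : ℤ)
    (L₂ : ℚ) : (Function.support (burgeTerm p p' r s M₁ L₁ M₂ L₂)).Finite :=
  ((finite_affine hp 0 (-M₁) M₂).union (finite_affine hp r (-M₁) M₂)).subset
    fun _ hj => burgeTerm_bounds hj

theorem finsum_burgeTerm {p : ℤ} (hp : 1 ≤ p) (p' r s M₁ : ℤ) (L₁ : ℚ) (M₂ : ℤ) (L₂ : ℚ) :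
    burgeX p p' r s M₁ L₁ M₂ L₂ =
      (∑ᶠ j : ℤ, qPow (posExp p p' r s (M₁ - M₂) j) * burgePair (p * j) (p' * j) M₁ L₁ M₂ L₂) -
      ∑ᶠ j : ℤ, qPow (negExp p p' r s (M₁ - M₂) j) *
        burgePair (p * j + r) (p' * j + s) M₁ L₁ M₂ L₂ := by
  unfold burgeX
  simp only [burgeTerm_eq]
  refine finsum_sub_distrib ?_ ?_
  · refine (finite_affine hp 0 (-M₁) M₂).subset fun j hj => ?_
    have := burgePair_bounds (right_ne_zero_of_mul hj)
    simpa using this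
  · exact (finite_affine hp r (-M₁) M₂).subset fun j hj =>
      burgePair_bounds (right_ne_zero_of_mul hj)

/-- The sum over `n` in the transform of a single product of two binomials. -/
noncomputable def pairSum (N : ℕ) (M₁ : ℤ) (L₁ : ℚ) (M₂ : ℤ) (L₂ : ℚ) (c t i : ℤ) : QSeries :=
  ∑ᶠ n, pairTerm N (M₁ - M₂ + 2 * c) (L₁ - c - t) (L₂ + c + t) (i - c) n

/-- Since `2 i + (M₁ - M₂) = 2 (i - c) + (M₁ - M₂ + 2 c)`, the shift `c` can be moved into `i` and
the parameters without changing the `(m,n)`-system. -/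
theorem weight_mul_burgePair (N : ℕ) (M₁ : ℤ) (L₁ : ℚ) (M₂ : ℤ) (L₂ : ℚ) (c t i : ℤ)
    (n : Fin (N - 1) → ℤ) :
    weight N (2 * i + (M₁ - M₂)) 0 n * burgePair c t (i + (M₁ - M₂))
      (L₁ - i + component (2 * i + (M₁ - M₂)) 0 (solution N (2 * i + (M₁ - M₂)) 0 n) 1 / 2) i
      (L₂ - (M₁ - M₂) - i +
        component (2 * i + (M₁ - M₂)) 0 (solution N (2 * i + (M₁ - M₂)) 0 n) 1 / 2)
    = pairTerm N (M₁ - M₂ + 2 * c) (L₁ - c - t) (L₂ + c + t) (i - c) n := by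
  have e : (((2 * (i - c) + (M₁ - M₂ + 2 * c) : ℤ)) : ℚ) = 2 * i + (M₁ - M₂) := by
    push_cast; ring
  simp only [pairTerm, burgePair, component_eq_path, e, Int.cast_zero]
  congr 2
  · congr 1
    · push_cast; ring
    · congr 1; ring
  · congr 1
    push_cast; ring

theorem pairSum_bounds {N : ℕ} {M₁ M₂ : ℤ} {L₁ L₂ : ℚ} {c t i : ℤ}
    (h : pairSum N M₁ L₁ M₂ L₂ c t i ≠ 0) : -(i + (M₁ - M₂)) ≤ c ∧ c ≤ i := by
  obtain ⟨n, hn⟩ := exists_ne_zero_of_finsum_ne_zero h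
  have := pairTerm_bounds hn
  omega

theorem transformInner_eq {N : ℕ} (hN : 1 ≤ N) {σ M₁ M₂ : ℤ} {L₁ : ℚ} (L₂ : ℚ)
    (hL : IsInt (L₁ + ((M₁ : ℚ) - M₂ + σ) / 2)) {p : ℤ} (hp : 1 ≤ p) (p' r s i : ℤ)
    (n : Fin (N - 1) → ℤ) :
    transformInner N σ p p' r s M₁ L₁ M₂ L₂ i n =
      (∑ᶠ j : ℤ, qPow (posExp p p' r s (M₁ - M₂) j) * pairTerm N (M₁ - M₂ + 2 * (p * j))
        (L₁ - (p * j : ℤ) - (p' * j : ℤ)) (L₂ + (p * j : ℤ) + (p' * j : ℤ)) (i - p * j) n) -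
      ∑ᶠ j : ℤ, qPow (negExp p p' r s (M₁ - M₂) j) * pairTerm N (M₁ - M₂ + 2 * (p * j + r))
        (L₁ - (p * j + r : ℤ) - (p' * j + s : ℤ)) (L₂ + (p * j + r : ℤ) + (p' * j + s : ℤ))
        (i - (p * j + r)) n := by
  have hz : ∀ c t : ℤ, ¬ Restricted N σ (2 * i + (M₁ - M₂)) n →
      pairTerm N (M₁ - M₂ + 2 * c) (L₁ - c - t) (L₂ + c + t) (i - c) n = 0 := by
    intro c t h
    refine pairTerm_eq_zero_of_not_restricted hN (σ := σ) (hL.of_eq (-t) (by push_cast; ring)) ?_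
    rwa [show 2 * (i - c) + (M₁ - M₂ + 2 * c) = 2 * i + (M₁ - M₂) by ring]
  unfold transformInner
  simp only []
  split_ifs with h
  · rw [finsum_burgeTerm hp, add_sub_cancel_left, mul_sub, mul_finsum, mul_finsum]
    congr 1
    · refine finsum_congr fun j => ?_
      rw [← weight_mul_burgePair]
      ring
    · refine finsum_congr fun j => ?_
      rw [← weight_mul_burgePair]
      ring
  · simp only [hz _ _ h, mul_zero, finsum_zero, sub_zero]

theorem finsum_transformInner {N : ℕ} (hN : 1 ≤ N) {σ M₁ M₂ : ℤ} {L₁ : ℚ} (L₂ : ℚ)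
    (hL : IsInt (L₁ + ((M₁ : ℚ) - M₂ + σ) / 2)) {p : ℤ} (hp : 1 ≤ p) (p' r s i : ℤ) :
    ∑ᶠ n, transformInner N σ p p' r s M₁ L₁ M₂ L₂ i n =
      (∑ᶠ j : ℤ, qPow (posExp p p' r s (M₁ - M₂) j) *
        pairSum N M₁ L₁ M₂ L₂ (p * j) (p' * j) i) -
      ∑ᶠ j : ℤ, qPow (negExp p p' r s (M₁ - M₂) j) *
        pairSum N M₁ L₁ M₂ L₂ (p * j + r) (p' * j + s) i := by
  have key : ∀ (e : ℤ → ℚ) (r s : ℤ),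
      {x : (Fin (N - 1) → ℤ) × ℤ | qPow (e x.2) * pairTerm N (M₁ - M₂ + 2 * (p * x.2 + r))
        (L₁ - (p * x.2 + r : ℤ) - (p' * x.2 + s : ℤ)) (L₂ + (p * x.2 + r : ℤ) + (p' * x.2 + s : ℤ))
        (i - (p * x.2 + r)) x.1 ≠ 0}.Finite := by
    intro e r s
    by_cases h0 : 0 ≤ 2 * i + (M₁ - M₂)
    · refine ((finite_support_weight hN h0 le_rfl).prod
        (finite_affine hp r (-(i + (M₁ - M₂))) i)).subset fun x hx => ?_
      have hx' := right_ne_zero_of_mul hx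
      have h1 := left_ne_zero_of_mul hx'
      rw [show 2 * (i - (p * x.2 + r)) + (M₁ - M₂ + 2 * (p * x.2 + r)) = 2 * i + (M₁ - M₂) by ring]
        at h1
      have h2 := pairTerm_bounds hx'
      refine ⟨h1, ?_, ?_⟩ <;> omega
    · refine Set.finite_empty.subset fun x hx => ?_
      have h2 := pairTerm_bounds (right_ne_zero_of_mul hx)
      exact absurd (show 0 ≤ 2 * i + (M₁ - M₂) by omega) h0
  have hfin : ∀ {f : (Fin (N - 1) → ℤ) → ℤ → QSeries},
      {x : (Fin (N - 1) → ℤ) × ℤ | f x.1 x.2 ≠ 0}.Finite →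
      (Function.support fun n => ∑ᶠ j, f n j).Finite := by
    intro f hf
    refine (hf.image Prod.fst).subset fun n hn => ?_
    obtain ⟨j, hj⟩ := exists_ne_zero_of_finsum_ne_zero hn
    exact ⟨(n, j), hj, rfl⟩
  have k1 := key (posExp p p' r s (M₁ - M₂)) 0 0
  simp only [add_zero] at k1
  have k2 := key (negExp p p' r s (M₁ - M₂)) r s
  simp only [transformInner_eq hN L₂ hL hp]
  rw [finsum_sub_distrib (hfin k1) (hfin k2)]
  refine congrArg₂ (· - ·) ((finsum_swap _ k1).trans ?_) ((finsum_swap _ k2).trans ?_) <;>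
    simp only [pairSum, mul_finsum]

/-- The generalized sum for shifted parameters, re-indexed by `i ↦ i - c`. The exponents combine by
`c (c + ℓ) + (i - c) (i + c + ℓ) = i (i + ℓ)` with `ℓ = M₁ - M₂`. -/
theorem qPow_mul_finsum_levelTerm {N : ℕ} (hN : 1 ≤ N) {M₁ M₂ : ℤ} {L₁ L₂ : ℚ} (c t : ℤ)
    (h : Admissible (N - 1) (M₁ - M₂ + 2 * c) (L₁ - c - t) (L₂ + c + t)) :
    qPow ((c : ℚ) * (c + (M₁ - M₂)) / N) *
      ∑ᶠ η, levelTerm N (M₁ + c) (L₁ - c - t) (M₂ - c) (L₂ + c + t) η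
    = ∑ᶠ i : ℤ, qPow ((i : ℚ) * (i + (M₁ - M₂)) / N) * (qBinom (L₁ + L₂ + M₂ - i) (M₂ - i : ℤ) *
      pairSum N M₁ L₁ M₂ L₂ c t i) := by
  have hN0 : (N : ℚ) ≠ 0 := by
    have : N ≠ 0 := by omega
    exact_mod_cast this
  have e : M₁ + c - (M₂ - c) = M₁ - M₂ + 2 * c := by ring
  rw [← e] at h
  rw [finsum_levelTerm_eq hN h, mul_finsum,
    ← finsum_comp_equiv (M := QSeries) (Equiv.subRight c)]
  refine finsum_congr fun i => ?_
  simp only [Equiv.subRight_apply, pairSum]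
  rw [← mul_assoc, ← qPow_add, e]
  congr 2
  · push_cast
    field_simp
    ring
  · congr 1
    · push_cast; ring
    · push_cast; ring

/-- Replacing `(p', s)` by `(p + N p', r + N s)` and dividing by `N` adds `c (c + M₁ - M₂) / N`,
with `c = p j`, to Burge's exponent. -/
theorem posTerm_eq {N : ℕ} (hN : 1 ≤ N) {σ M₁ M₂ : ℤ} {L₁ : ℚ} (L₂ : ℚ)
    (hL : IsInt (L₁ + ((M₁ : ℚ) - M₂ + σ) / 2)) (p p' r s j : ℤ) :
    posTerm N σ p (p + N * p') r (r + N * s) M₁ L₁ M₂ L₂ j =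
      qPow (posExp p p' r s (M₁ - M₂) j) *
        (qPow (((p * j : ℤ) : ℚ) * ((p * j : ℤ) + (M₁ - M₂)) / N) *
        ∑ᶠ η, levelTerm N (M₁ + p * j) (L₁ - (p * j : ℤ) - (p' * j : ℤ)) (M₂ - p * j)
          (L₂ + (p * j : ℤ) + (p' * j : ℤ)) η) := by
  have hN0 : (N : ℚ) ≠ 0 := by
    have : N ≠ 0 := by omega
    exact_mod_cast this
  unfold posTerm
  conv_rhs => rw [← mul_assoc, ← qPow_add]
  simp only [posInner_eq hN L₂ hL]
  refine qPow_mul_eq ?_ _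
  simp only [posExp]
  push_cast
  field_simp
  ring

theorem negTerm_eq {N : ℕ} (hN : 1 ≤ N) {σ M₁ M₂ : ℤ} {L₁ : ℚ} (L₂ : ℚ)
    (hL : IsInt (L₁ + ((M₁ : ℚ) - M₂ + σ) / 2)) (p p' r s j : ℤ) :
    negTerm N σ p (p + N * p') r (r + N * s) M₁ L₁ M₂ L₂ j =
      qPow (negExp p p' r s (M₁ - M₂) j) *
        (qPow (((p * j + r : ℤ) : ℚ) * ((p * j + r : ℤ) + (M₁ - M₂)) / N) *
        ∑ᶠ η, levelTerm N (M₁ + (p * j + r)) (L₁ - (p * j + r : ℤ) - (p' * j + s : ℤ))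
          (M₂ - (p * j + r)) (L₂ + (p * j + r : ℤ) + (p' * j + s : ℤ)) η) := by
  have hN0 : (N : ℚ) ≠ 0 := by
    have : N ≠ 0 := by omega
    exact_mod_cast this
  unfold negTerm
  conv_rhs => rw [← mul_assoc, ← qPow_add]
  simp only [negInner_eq hN L₂ hL]
  refine qPow_mul_eq ?_ _
  simp only [negExp]
  push_cast
  field_simp
  ring

theorem levelXFinite {N : ℕ} (hN : 1 ≤ N) {σ M₁ M₂ : ℤ} {L₁ : ℚ} (L₂ : ℚ)
    (hL : IsInt (L₁ + ((M₁ : ℚ) - M₂ + σ) / 2)) {p : ℤ} (hp : 1 ≤ p) (p' r s : ℤ) :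
    LevelXFinite N σ p (p + N * p') r (r + N * s) M₁ L₁ M₂ L₂ := by
  refine ⟨fun j => ?_, fun j => ?_, ?_, ?_⟩
  · rw [funext (posInner_eq hN L₂ hL p p' j)]
    exact finite_support_levelTerm hN _ _ _ _
  · rw [funext (negInner_eq hN L₂ hL p p' r s j)]
    exact finite_support_levelTerm hN _ _ _ _
  · refine (finite_affine hp 0 (-M₁) M₂).subset fun j hj => ?_
    rw [Function.mem_support, posTerm_eq hN L₂ hL] at hj
    obtain ⟨η, hη⟩ := exists_ne_zero_of_finsum_ne_zero
      (right_ne_zero_of_mul (right_ne_zero_of_mul hj))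
    have := levelTerm_bounds hη
    constructor <;> omega
  · refine (finite_affine hp r (-M₁) M₂).subset fun j hj => ?_
    rw [Function.mem_support, negTerm_eq hN L₂ hL] at hj
    obtain ⟨η, hη⟩ := exists_ne_zero_of_finsum_ne_zero
      (right_ne_zero_of_mul (right_ne_zero_of_mul hj))
    have := levelTerm_bounds hη
    constructor <;> omega

/-! ### Finiteness of the transform and reduction to `Admissible` -/

theorem transformInner_bounds {N : ℕ} {σ p p' r s M₁ M₂ : ℤ} {L₁ L₂ : ℚ} {i : ℤ}
    {n : Fin (N - 1) → ℤ} (h : transformInner N σ p p' r s M₁ L₁ M₂ L₂ i n ≠ 0) :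
    0 ≤ 2 * i + (M₁ - M₂) ∧ weight N ((2 * i + (M₁ - M₂) : ℤ) : ℚ) (0 : ℤ) n ≠ 0 := by
  unfold transformInner at h
  simp only [] at h
  split_ifs at h with h'
  · obtain ⟨j, hj⟩ := exists_ne_zero_of_finsum_ne_zero (right_ne_zero_of_mul h)
    have h1 := burgeTerm_bounds hj
    refine ⟨by omega, ?_⟩
    have h2 := left_ne_zero_of_mul h
    push_cast
    exact h2
  · exact absurd rfl h

theorem finite_support_transformInner {N : ℕ} (hN : 1 ≤ N) (σ p p' r s M₁ : ℤ) (L₁ : ℚ) (M₂ : ℤ)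
    (L₂ : ℚ) (i : ℤ) :
    (Function.support (transformInner N σ p p' r s M₁ L₁ M₂ L₂ i)).Finite := by
  by_cases h : 0 ≤ 2 * i + (M₁ - M₂)
  · exact (finite_support_weight hN h le_rfl).subset fun n hn => (transformInner_bounds hn).2
  · exact Set.finite_empty.subset fun n hn => h (transformInner_bounds hn).1

theorem transformTerm_bounds {N : ℕ} {σ p p' r s M₁ M₂ : ℤ} {L₁ L₂ : ℚ} {i : ℤ}
    (h : transformTerm N σ p p' r s M₁ L₁ M₂ L₂ i ≠ 0) : 0 ≤ 2 * i + (M₁ - M₂) ∧ i ≤ M₂ := by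
  obtain ⟨n, hn⟩ := exists_ne_zero_of_finsum_ne_zero (right_ne_zero_of_mul h)
  have h1 := (bounds_of_qBinom_ne_zero (right_ne_zero_of_mul (left_ne_zero_of_mul h))).1
  exact ⟨(transformInner_bounds hn).1, by exact_mod_cast sub_nonneg.mp h1⟩

theorem finite_support_transformTerm (N : ℕ) (σ p p' r s M₁ : ℤ) (L₁ : ℚ) (M₂ : ℤ) (L₂ : ℚ) :
    (Function.support (transformTerm N σ p p' r s M₁ L₁ M₂ L₂)).Finite := by
  refine finite_of_bounds (-|M₁ - M₂|) M₂ fun i hi => ?_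
  have := transformTerm_bounds hi
  have := le_abs_self (M₁ - M₂)
  have := neg_abs_le (M₁ - M₂)
  omega

theorem levelX_eq_finsum_transformTerm {N : ℕ} (hN : 1 ≤ N) {σ M₁ M₂ : ℤ} {L₁ L₂ : ℚ}
    (hL : IsInt (L₁ + ((M₁ : ℚ) - M₂ + σ) / 2)) {p : ℤ} (hp : 1 ≤ p) {p' r s : ℤ}
    (h₀ : ∀ j : ℤ, Admissible (N - 1) (M₁ - M₂ + 2 * (p * j))
      (L₁ - (p * j : ℤ) - (p' * j : ℤ)) (L₂ + (p * j : ℤ) + (p' * j : ℤ)))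
    (h₁ : ∀ j : ℤ, Admissible (N - 1) (M₁ - M₂ + 2 * (p * j + r))
      (L₁ - (p * j + r : ℤ) - (p' * j + s : ℤ)) (L₂ + (p * j + r : ℤ) + (p' * j + s : ℤ))) :
    levelX N σ p (p + N * p') r (r + N * s) M₁ L₁ M₂ L₂ =
      ∑ᶠ i : ℤ, transformTerm N σ p p' r s M₁ L₁ M₂ L₂ i := by
  set A : ℤ → QSeries := fun i => qPow ((i : ℚ) * (i + (M₁ - M₂)) / N) *
    qBinom (L₁ + L₂ + M₂ - i) (M₂ - i : ℤ) with hA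
  have hfin : ∀ (e : ℤ → ℚ) (r s : ℤ), {x : ℤ × ℤ | A x.1 *
      (qPow (e x.2) * pairSum N M₁ L₁ M₂ L₂ (p * x.2 + r) (p' * x.2 + s) x.1) ≠ 0}.Finite := by
    intro e r s
    refine ((Set.finite_Icc (-|M₁ - M₂|) M₂).prod
      (finite_affine hp r (-(M₂ + (M₁ - M₂))) M₂)).subset fun x hx => ?_
    have b1 := pairSum_bounds (right_ne_zero_of_mul (right_ne_zero_of_mul hx))
    have b2 := (bounds_of_qBinom_ne_zero (right_ne_zero_of_mul (left_ne_zero_of_mul hx))).1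
    have b3 : 0 ≤ M₂ - x.1 := by exact_mod_cast b2
    have := le_abs_self (M₁ - M₂)
    have := neg_abs_le (M₁ - M₂)
    refine ⟨⟨?_, ?_⟩, ?_, ?_⟩ <;> omega
  have hfin' : ∀ {f : ℤ → ℤ → QSeries}, {x : ℤ × ℤ | f x.1 x.2 ≠ 0}.Finite →
      (Function.support fun i => ∑ᶠ j, f i j).Finite := by
    intro f hf
    refine (hf.image Prod.fst).subset fun n hn => ?_
    obtain ⟨j, hj⟩ := exists_ne_zero_of_finsum_ne_zero hn
    exact ⟨(n, j), hj, rfl⟩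
  have k1 := hfin (posExp p p' r s (M₁ - M₂)) 0 0
  simp only [add_zero] at k1
  have k2 := hfin (negExp p p' r s (M₁ - M₂)) r s
  have hT : ∀ i : ℤ, transformTerm N σ p p' r s M₁ L₁ M₂ L₂ i =
      (∑ᶠ j : ℤ, A i * (qPow (posExp p p' r s (M₁ - M₂) j) *
        pairSum N M₁ L₁ M₂ L₂ (p * j) (p' * j) i)) -
      ∑ᶠ j : ℤ, A i * (qPow (negExp p p' r s (M₁ - M₂) j) *
        pairSum N M₁ L₁ M₂ L₂ (p * j + r) (p' * j + s) i) := by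
    intro i
    unfold transformTerm
    rw [finsum_transformInner hN L₂ hL hp, mul_sub, mul_finsum, mul_finsum]
    simp only [hA, Int.cast_sub]
  rw [finsum_congr hT, finsum_sub_distrib (hfin' k1) (hfin' k2)]
  refine congrArg₂ (· - ·) (Eq.trans ?_ (finsum_swap _ k1).symm)
    (Eq.trans ?_ (finsum_swap _ k2).symm)
  · refine finsum_congr fun j => ?_
    rw [posTerm_eq hN L₂ hL, qPow_mul_finsum_levelTerm hN _ _ (h₀ j), mul_finsum]
    refine finsum_congr fun i => ?_
    simp only [hA]
    ring
  · refine finsum_congr fun j => ?_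
    rw [negTerm_eq hN L₂ hL, qPow_mul_finsum_levelTerm hN _ _ (h₁ j), mul_finsum]
    refine finsum_congr fun i => ?_
    simp only [hA]
    ring

/-! ### The conditions on integer parts -/

/-- An inequality between integer parts says that every integer below the first quotient is below
the second. -/
theorem mul_le_of_floor_le {A B D E : ℚ} (hD : 0 < D) (hE : 0 < E) (h : ⌊A / D⌋ ≤ ⌊B / E⌋)
    {j : ℤ} (hj : D * j ≤ A) : E * j ≤ B := by
  have h1 : j ≤ ⌊A / D⌋ := Int.le_floor.mpr (by rw [le_div_iff₀ hD]; linarith)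
  have h2 := Int.le_floor.mp (h1.trans h)
  rw [le_div_iff₀ hE] at h2
  linarith

theorem admissible_iff {N : ℕ} (hN : 1 ≤ N) (p p' r s ℓ j : ℤ) (L₁ L₂ : ℚ) :
    Admissible (N - 1) (ℓ + 2 * (p * j + r)) (L₁ - (p * j + r : ℤ) - (p' * j + s : ℤ))
      (L₂ + (p * j + r : ℤ) + (p' * j + s : ℤ)) ↔
    (((p' : ℚ) + p / N) * j ≤ L₁ + ℓ * (N - 1) / (2 * N) - s - r / N →
      ((p' : ℚ) + p / N) * (-j : ℤ) ≤ L₂ - ℓ * (N - 1) / (2 * N) + s + r / N →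
      (((p' : ℚ) - p) * j ≤ L₁ + ℓ + r - s ∨ L₂ + 2 * (p' * j + s) ≤ L₁ + ℓ) ∧
      (((p' : ℚ) - p) * (-j : ℤ) ≤ L₂ - ℓ - r + s ∨ L₁ + ℓ ≤ L₂ + 2 * (p' * j + s))) := by
  have hN0 : (N : ℚ) ≠ 0 := by
    have : N ≠ 0 := by omega
    exact_mod_cast this
  have hc : ((N - 1 : ℕ) : ℚ) = N - 1 := by
    rw [Nat.cast_sub hN, Nat.cast_one]
  unfold Admissible
  rw [hc, sub_add_cancel]
  push_cast
  have e : ((ℓ : ℚ) + 2 * (p * j + r)) * (N - 1) / (2 * N)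
      = ℓ * (N - 1) / (2 * N) + (p * j + r) - (p / N * j + r / N) := by
    field_simp
    ring
  rw [e]
  refine imp_congr ?_ (imp_congr ?_ (and_congr (or_congr ?_ ?_) (or_congr ?_ ?_))) <;>
    constructor <;> intro h <;> linarith

/-- The premises bound `j` and `-j` by the left-hand quotients of the two inequalities, so the first
alternative holds in both places. -/
theorem admissible_of_floorCond {N : ℕ} (hN : 1 ≤ N) {p p' r s M₁ M₂ : ℤ} {L₁ L₂ : ℚ}
    (hp : 1 ≤ p) (hpp' : p < p') (h : FloorCond N p p' r s M₁ L₁ M₂ L₂) (j : ℤ) :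
    Admissible (N - 1) (M₁ - M₂ + 2 * (p * j + r)) (L₁ - (p * j + r : ℤ) - (p' * j + s : ℤ))
      (L₂ + (p * j + r : ℤ) + (p' * j + s : ℤ)) := by
  have hp0 : (0 : ℚ) < p := by exact_mod_cast (show 0 < p by omega)
  have hpp : (p : ℚ) < p' := by exact_mod_cast hpp'
  have hD : (0 : ℚ) < p' + p / N := by
    have : (0 : ℚ) ≤ p / N := by positivity
    linarith
  rw [admissible_iff hN]
  push_cast
  intro h1 h2
  refine ⟨Or.inl (mul_le_of_floor_le hD (by linarith) h.1 h1), Or.inl ?_⟩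
  have := mul_le_of_floor_le (j := -j) hD (show (0 : ℚ) < p' - p by linarith) h.2
    (by push_cast; exact h2)
  push_cast at this
  exact this

/-- The sign of `t = p' j + s` decides one alternative. For `j ≥ 0` it is non-negative, and the
other condition follows from `p' - p ≤ p' + p / N`. For `j < 0` it is non-positive because `s ≤ p'`,
and the other condition is `h` at `k = -j`. -/
theorem admissible_symm {N : ℕ} (hN : 1 ≤ N) {p p' r s : ℤ} {L : ℚ} (hp : 1 ≤ p) (hpp' : p < p')
    (hr : 0 ≤ r) (hs : 0 ≤ s) (hs' : s ≤ p')
    (h : ∀ k : ℤ, 1 ≤ k → ((p' : ℚ) + p / N) * k ≤ L + s + r / N →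
      ((p' : ℚ) - p) * k ≤ L - r + s) (j : ℤ) :
    Admissible (N - 1) (2 * (p * j + r)) (L - (p * j + r : ℤ) - (p' * j + s : ℤ))
      (L + (p * j + r : ℤ) + (p' * j + s : ℤ)) := by
  have hp0 : (0 : ℚ) < p := by exact_mod_cast (show 0 < p by omega)
  have hpp : (p : ℚ) < p' := by exact_mod_cast hpp'
  have hr0 : (0 : ℚ) ≤ r := by exact_mod_cast hr
  have hs0 : (0 : ℚ) ≤ s := by exact_mod_cast hs
  have hpN : (0 : ℚ) ≤ p / N := by positivity
  have hrN : (0 : ℚ) ≤ r / N := by positivity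
  have key := admissible_iff hN p p' r s 0 j L L
  rw [zero_add] at key
  rw [key]
  push_cast
  simp only [zero_mul, zero_div, add_zero, sub_zero]
  intro h1 h2
  rcases le_or_gt 0 j with hj | hj
  · have hj0 : (0 : ℚ) ≤ j := by exact_mod_cast hj
    have m1 := mul_nonneg hp0.le hj0
    have m2 := mul_nonneg hpN hj0
    have m3 := mul_nonneg (hp0.le.trans hpp.le) hj0
    exact ⟨Or.inl (by linarith), Or.inr (by linarith)⟩
  · have ht : p' * j + s ≤ 0 := by nlinarith
    have ht0 : (p' : ℚ) * j + s ≤ 0 := by exact_mod_cast ht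
    have := h (-j) (by omega) (by push_cast; exact h2)
    push_cast at this
    exact ⟨Or.inr (by linarith), Or.inl this⟩

end Burge

/-! ### The general and the symmetric case -/

theorem mainTheorem2 (N : ℕ) (hN : 1 ≤ N) (σ : ℤ) (hσ : σ = 0 ∨ σ = 1)
    (p p' r s : ℤ) (hp : 1 ≤ p) (hpp' : p < p') :
    -- Burge's polynomials on the right-hand sides are finite sums
    (∀ (A : ℤ) (B : ℚ) (A' : ℤ) (B' : ℚ),
      (Function.support (burgeTerm p p' r s A B A' B')).Finite) ∧
    -- the general case
    (∀ (M₁ M₂ : ℤ) (L₁ L₂ : ℚ), Even (M₁ - M₂ + σ * N) →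
      IsInt (L₁ + ((M₁ - M₂ : ℚ) + σ) / 2) → IsInt (L₂ + ((M₁ - M₂ : ℚ) + σ) / 2) →
      FloorCond N p p' r s M₁ L₁ M₂ L₂ → FloorCond N p p' 0 0 M₁ L₁ M₂ L₂ →
      LevelXFinite N σ p (p + N * p') r (r + N * s) M₁ L₁ M₂ L₂ ∧
      (∀ i, (Function.support (transformInner N σ p p' r s M₁ L₁ M₂ L₂ i)).Finite) ∧
      (Function.support (transformTerm N σ p p' r s M₁ L₁ M₂ L₂)).Finite ∧
      levelX N σ p (p + N * p') r (r + N * s) M₁ L₁ M₂ L₂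
        = ∑ᶠ i : ℤ, transformTerm N σ p p' r s M₁ L₁ M₂ L₂ i) ∧
    -- the symmetric case
    (0 ≤ r → r ≤ p → 0 ≤ s → s ≤ p' →
      ∀ (M : ℤ) (L : ℚ), Even (σ * N) → IsInt (L + (σ : ℚ) / 2) →
      FloorCondSymm N p p' r s L →
      LevelXFinite N σ p (p + N * p') r (r + N * s) M L M L ∧
      (∀ i, (Function.support (transformInner N σ p p' r s M L M L i)).Finite) ∧
      levelX N σ p (p + N * p') r (r + N * s) M L M L
        = ∑ i ∈ Finset.Icc 0 M, qPow ((i : ℚ) ^ 2 / N) * qBinom (2 * L + M - i) (2 * L) *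
            ∑ᶠ n : Fin (N - 1) → ℤ, transformInner N σ p p' r s M L M L i n) := by
  have symm_eq : ∀ (M : ℤ) (L : ℚ), FloorCondSymm N p p' r s L → 0 ≤ r → 0 ≤ s → s ≤ p' →
      IsInt (L + (σ : ℚ) / 2) →
      levelX N σ p (p + N * p') r (r + N * s) M L M L
        = ∑ᶠ i : ℤ, transformTerm N σ p p' r s M L M L i := by
    intro M L hF hr hs hs' hL
    have hp0 : (0 : ℚ) < p := by exact_mod_cast (show 0 < p by omega)
    have hpp : (p : ℚ) < p' := by exact_mod_cast hpp'
    have hpN : (0 : ℚ) ≤ p / N := by positivity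
    refine levelX_eq_finsum_transformTerm hN (by simpa using hL) hp (fun j => ?_) (fun j => ?_)
    -- For the positive part no inequality has to be assumed: with `r = s = 0` and `k ≥ 1` it
    -- follows from `p' - p ≤ p' + p / N`.
    · have := admissible_symm (r := 0) (s := 0) (L := L) hN hp hpp' le_rfl le_rfl (by omega)
        (fun k hk h => by
          have hk0 : (1 : ℚ) ≤ k := by exact_mod_cast hk
          have m1 := mul_nonneg hpN (zero_le_one.trans hk0)
          have m2 := mul_nonneg hp0.le (zero_le_one.trans hk0)
          push_cast at h ⊢
          rw [zero_div] at h
          linarith) j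
      simpa using this
    · have := admissible_symm (L := L) hN hp hpp' hr hs hs'
        (fun k _ h => mul_le_of_floor_le (by linarith) (by linarith) hF h) j
      simpa using this
  refine ⟨fun A B A' B' => finite_support_burgeTerm hp p' r s A B A' B', ?_, ?_⟩
  · intro M₁ M₂ L₁ L₂ _ hL₁ _ hF hF₀
    refine ⟨levelXFinite hN L₂ hL₁ hp p' r s, finite_support_transformInner hN σ p p' r s M₁ L₁ M₂ L₂,
      finite_support_transformTerm N σ p p' r s M₁ L₁ M₂ L₂,
      levelX_eq_finsum_transformTerm hN hL₁ hp (fun j => ?_)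
        (admissible_of_floorCond hN hp hpp' hF)⟩
    simpa using admissible_of_floorCond hN hp hpp' hF₀ j
  · intro hr _ hs hs' M L _ hL hF
    have hL' : IsInt (L + ((M : ℚ) - M + σ) / 2) := by simpa using hL
    refine ⟨levelXFinite hN L hL' hp p' r s, finite_support_transformInner hN σ p p' r s M L M L, ?_⟩
    rw [symm_eq M L hF hr hs hs' hL, finsum_eq_sum_of_support_subset (s := Finset.Icc 0 M)]
    · refine Finset.sum_congr rfl fun i _ => ?_
      unfold transformTerm
      -- This passes from the lower entry `M - i` of the general case to `2 L`.
      rw [← qBinom_symm (2 * L + M - i) (2 * L)]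
      congr 2
      · congr 1
        ring
      · congr 1 <;> ring
    · intro i hi
      have := transformTerm_bounds hi
      simp only [Finset.coe_Icc, Set.mem_Icc]
      omega
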